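/- Let $d\ge 1$, equip $\mathbb R^{\mathbb Z^d}$ with the product $\sigma$-algebra, and let $l_0=\{x\in\mathbb R^{\mathbb Z^d}: |x_i|\to 0 \text{ as } |i|\to\infty\}$, $\|x\|=\sup_i|x_i|$, and $(\theta^k x)_i=x_{i+k}$. Definitions. A random field $Y=(Y_i)_{i\in\mathbb Z^d}$ is the tail process of a stationary real random field $X$ if $P(|X_0|>u)>0$ for all $u$, $|Y_0|>1$ a.s., and for every $m$ the law of $(u^{-1}X_i)_{i\in\{-m,\dots,m\}^d}$ conditionally on $|X_0|>u$ converges weakly to the law of $(Y_i)_{i\in\{-m,\dots,m\}^d}$ as $u\to\infty$. A stationary $X$ is regularly varying with tail index $\alpha>0$ if it has a tail process $Y$ and $|Y_0|$ is $\mathrm{Pareto}(\alpha)$-distributed, i.e. $P(|Y_0|>y)=y^{-\alpha}$ for $y\ge1$; then $Y$ is said to have tail index $\alpha$, and its spectral tail process is $\Theta=Y/|Y_0|$. Let $e(x)=\{k:|x_k|>1\}$ and $\mathbb E_0=\{x: 0\in e(x),\ |e(x)|<\infty\}$. The (candidate) extremal index of a tail process $Y$ with values in $l_0$ is $\vartheta=E[1/|e(Y)|]$.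 An anchoring function is a measurable $A:\mathbb E_0\to\mathbb Z^d$ with $A(x)\in e(x)$ and $A(\theta^k x)+k=A(x)$ for all $x\in\mathbb E_0$, $k\in e(x)$; the anchored process $Z^A$ has the law of $Y$ conditionally on $A(Y)=0$, and $Q^A=Z^A/\|Z^A\|$. A random element $Q$ of $l_0$ is a representative of the anchored spectral tail process of $Y$ if $E[h(Q)]=E[h(Q^A)]$ for all measurable $h:l_0\to[0,\infty)$ with $h\circ\theta^k=h$ for all $k$, for at least one, and then for every, anchoring function $A$. Proposition. Let $C=(C_i)_{i\in\mathbb Z^d}$ be a random element of $l_0$ and $\alpha>0$ such that $$c:=\sum_{k\in\mathbb Z^d}E\big[|C_k|^\alpha\big]\in(0,\infty),$$ and let $\kappa$ be a $\{-1,1\}$-valued random variable independent of $C$. Consider, for a random element $\Theta$ of $l_0$, the relation $$E[h(\Theta)]=\frac1c\,E\Big[\sum_{k\in\mathbb Z^d}h\Big(\frac{\kappa\,\theta^kC}{|C_k|}\Big)|C_k|^\alpha\Big]\quad\text{for all measurable }h:l_0\to[0,\infty),\qquad(*)$$ where the $k$th summand is $0$ if $C_k=0$. (i) If $\Theta$ is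 a random element of $l_0$ satisfying $(*)$, then $\Theta$ is (in law) the spectral tail process of some stationary regularly varying random field with tail index $\alpha$. (ii) Let $Y$ be a tail process, with values in $l_0$, of some stationary regularly varying random field with tail index $\alpha$, and suppose that its spectral tail process $\Theta$ satisfies $(*)$. Then every random element $Q$ of $l_0$ with distribution $$P(Q\in\cdot)=\frac{1}{E[\|C\|^\alpha]}\,E\Big[\mathbf 1\Big\{\frac{\kappa\,C}{\|C\|}\in\cdot\Big\}\|C\|^\alpha\Big]$$ is a representative of the anchored spectral tail process of $Y$, and the extremal index of $Y$ is $$\vartheta=\frac{E[\|C\|^\alpha]}{\sum_{k\in\mathbb Z^d}E[|C_k|^\alpha]}.$$ -/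

import Mathlib

open MeasureTheory ProbabilityTheory Filter Topology
open scoped ENNReal NNReal BoundedContinuousFunction

namespace TailField

/-- The index set `ℤ^d`. -/
abbrev Lattice (d : ℕ) : Type := Fin d → ℤ

/-- The space `ℝ^{ℤ^d}`, with the product topology and the product `σ`-algebra. -/
abbrev Path (d : ℕ) : Type := Lattice d → ℝ

/-- The shift `(θ^k x)_i = x_{i+k}`, moving the origin to `k`. -/
def shift {d : ℕ} (k : Lattice d) (x : Path d) : Path d := fun i => x (i + k)

/-- A function is shift-invariant on `B`. -/
def ShiftInvariantOn {d : ℕ} {β : Type*} (h : Path d → β) (B : Set (Path d)) : Prop :=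
  ∀ x ∈ B, ∀ k : Lattice d, h (shift k x) = h x

/-- The space `l₀` of fields vanishing at infinity. Balls of `ℤ^d` are finite, so `|i| → ∞` is
convergence along the cofinite filter. -/
def l0 (d : ℕ) : Set (Path d) := {x | Tendsto (fun i => |x i|) cofinite (𝓝 0)}

/-- The uniform norm `‖x‖ = sup_i |x_i|`, used for `x ∈ l₀` only (where the supremum is finite). -/
noncomputable def supNorm {d : ℕ} (x : Path d) : ℝ := ⨆ i, |x i|

/-- The set `e(x)` of exceedance points. -/
def exceedances {d : ℕ} (x : Path d) : Set (Lattice d) := {k | 1 < |x k|}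

/-- The space `𝔼₀`: an exceedance point at the origin, and finitely many exceedance points. -/
def E0 (d : ℕ) : Set (Path d) := {x | 0 ∈ exceedances x ∧ (exceedances x).Finite}

/-! ### Tail processes (in terms of the laws of the random fields on `ℝ^{ℤ^d}`) -/

/-- Strict stationarity of a random field with law `μ`. -/
def IsStationary {d : ℕ} (μ : Measure (Path d)) : Prop :=
  ∀ k : Lattice d, μ.map (shift k) = μ

/-- The hypercube `{-m,…,m}^d`. -/
def box (d m : ℕ) : Set (Lattice d) := {i | ∀ j, |i j| ≤ (m : ℤ)}

/-- A random field `Y` with law `μY` is the tail process of a random field `X` with law `μX`: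
`|Y_0| > 1` a.s., and for every `m` the law of `(u⁻¹ X_i)_{i ∈ {-m,…,m}^d}` conditionally on
`|X_0| > u` converges weakly to the law of `(Y_i)_{i ∈ {-m,…,m}^d}` as `u → ∞`. -/
structure IsTailProcessOf {d : ℕ} (μX μY : Measure (Path d)) : Prop where
  tail_pos : ∀ u : ℝ, 0 < μX {x | u < |x 0|}
  exceeds : ∀ᵐ y ∂μY, 1 < |y 0|
  tendsto : ∀ (m : ℕ) (f : (box d m → ℝ) →ᵇ ℝ),
    Tendsto (fun u : ℝ => ∫ x, f (fun i => u⁻¹ * x i) ∂(cond μX {x | u < |x 0|}))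
      atTop (𝓝 (∫ y, f (fun i => y i) ∂μY))

/-- `μY` is the law of the tail process of some stationary regularly varying random field with
tail index `α`. Regular variation of the stationary field is the existence of its tail process
`Y`, and the tail index is the `α` for which `|Y_0|` is `Pareto(α)`-distributed. -/
def IsTailProcess {d : ℕ} (α : ℝ) (μY : Measure (Path d)) : Prop :=
  ∃ μX : Measure (Path d), IsProbabilityMeasure μX ∧ IsStationary μX ∧
    IsTailProcessOf μX μY ∧ μY.map (fun y => |y 0|) = paretoMeasure 1 α

/-- `y ↦ y / |y_0|`, which sends a tail process to its spectral tail process. -/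
noncomputable def spectral {d : ℕ} (y : Path d) : Path d := fun i => |y 0|⁻¹ * y i

/-- `μΘ` is the law of the spectral tail process of some stationary regularly varying random
field with tail index `α`. -/
def IsSpectralTailProcess {d : ℕ} (α : ℝ) (μΘ : Measure (Path d)) : Prop :=
  ∃ μY : Measure (Path d), IsProbabilityMeasure μY ∧ IsTailProcess α μY ∧
    μΘ = μY.map spectral

/-- The (candidate) extremal index `ϑ = E[1 / |e(Y)|]` of a tail process `Y` with law `μY`. -/
noncomputable def extremalIndex {d : ℕ} (μY : Measure (Path d)) : ℝ≥0∞ :=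
  ∫⁻ y, ((exceedances y).encard : ℝ≥0∞)⁻¹ ∂μY

/-! ### Anchoring -/

/-- `A` is an anchoring function: a measurable shift-covariant exceedance map on `𝔼₀`
(the values of `A` outside `𝔼₀` are irrelevant). -/
structure IsAnchoring {d : ℕ} (A : Path d → Lattice d) : Prop where
  measurable : Measurable (fun x : E0 d => A x)
  mem : ∀ x ∈ E0 d, A x ∈ exceedances x
  covariant : ∀ x ∈ E0 d, ∀ k ∈ exceedances x, A (shift k x) + k = A x

/-- The law of the anchored tail process `Z^A`: the law of `Y` conditionally on `A(Y) = 0`. -/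
noncomputable def anchoredLaw {d : ℕ} (A : Path d → Lattice d) (μY : Measure (Path d)) :
    Measure (Path d) :=
  cond μY {y | y ∈ E0 d ∧ A y = 0}

/-- `E[h(Q)] = E[h(Q^A)]`, with `Q^A = Z^A / ‖Z^A‖`, for all measurable shift-invariant
`h : l₀ → ℝ₊`. -/
def RepresentsAnchor {d : ℕ} (A : Path d → Lattice d) (μY μQ : Measure (Path d)) : Prop :=
  ∀ h : Path d → ℝ≥0, Measurable h → ShiftInvariantOn h (l0 d) →
    ∫⁻ q, (h q : ℝ≥0∞) ∂μQ = ∫⁻ z, (h ((supNorm z)⁻¹ • z) : ℝ≥0∞) ∂(anchoredLaw A μY)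

/-- A random element `Q` of `l₀` with law `μQ` is a representative of the anchored spectral tail
process of `Y` (with law `μY`): the above holds for at least one, and for every, anchoring
function. -/
structure IsAnchoredSpectralRepresentative {d : ℕ} (μY μQ : Measure (Path d)) : Prop where
  mem_l0 : ∀ᵐ q ∂μQ, q ∈ l0 d
  exists_anchor : ∃ A : Path d → Lattice d, IsAnchoring A ∧ RepresentsAnchor A μY μQ
  forall_anchor : ∀ A : Path d → Lattice d, IsAnchoring A → RepresentsAnchor A μY μQ

/-! ### The moving-average formulas -/

/-- `c = ∑_k E|C_k|^α`. -/
noncomputable def coeffMass {d : ℕ} {Ω : Type*} [MeasurableSpace Ω] (P : Measure Ω)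
    (C : Ω → Path d) (α : ℝ) : ℝ≥0∞ :=
  ∑' k, ∫⁻ ω, ENNReal.ofReal (|C ω k| ^ α) ∂P

/-- `E‖C‖^α`. -/
noncomputable def normMoment {d : ℕ} {Ω : Type*} [MeasurableSpace Ω] (P : Measure Ω)
    (C : Ω → Path d) (α : ℝ) : ℝ≥0∞ :=
  ∫⁻ ω, ENNReal.ofReal (supNorm (C ω) ^ α) ∂P

/-- The law `μΘ` satisfies, for all measurable `h ≥ 0`,
`E[h(Θ)] = c⁻¹ E[∑_k h(κ θ^k C / |C_k|) |C_k|^α]`. The `k`-th summand vanishes where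
`C_k = 0`, because `0 ^ α = 0` for `α > 0`. -/
def IsMASpectralLaw {d : ℕ} {Ω : Type*} [MeasurableSpace Ω] (P : Measure Ω)
    (C : Ω → Path d) (κ : Ω → ℝ) (α : ℝ) (μΘ : Measure (Path d)) : Prop :=
  ∀ h : Path d → ℝ≥0, Measurable h →
    ∫⁻ x, (h x : ℝ≥0∞) ∂μΘ =
      (coeffMass P C α)⁻¹ *
        ∫⁻ ω, ∑' k, (h ((κ ω / |C ω k|) • shift k (C ω)) : ℝ≥0∞) *
          ENNReal.ofReal (|C ω k| ^ α) ∂P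

/-- The law `μQ` is
`P(Q ∈ B) = E[1{κ C / ‖C‖ ∈ B} ‖C‖^α] / E‖C‖^α` for measurable `B`. -/
def IsMAAnchoredLaw {d : ℕ} {Ω : Type*} [MeasurableSpace Ω] (P : Measure Ω)
    (C : Ω → Path d) (κ : Ω → ℝ) (α : ℝ) (μQ : Measure (Path d)) : Prop :=
  ∀ B : Set (Path d), MeasurableSet B →
    μQ B = (normMoment P C α)⁻¹ *
      ∫⁻ ω, B.indicator (fun _ => (1 : ℝ≥0∞)) ((κ ω / supNorm (C ω)) • C ω) *
        ENNReal.ofReal (supNorm (C ω) ^ α) ∂P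

end TailField

/-!
Let `π` be the law of `κ C`. Superposing the paths `s θ^k x` with intensity `π(dx) α s^{-α-1} ds`
over all `k ∈ ℤ^d` gives a shift-invariant, `α`-homogeneous measure: the tail measure. In polar
coordinates with respect to `|y_0|`, its restriction to `{|y_0| > 1}` is the product of the
`Pareto(α)` law and `c` times the law in `(∗)`; modulo shifts and in polar coordinates with respect
to `‖y‖`, its angular part is the unnormalised law of `Q`.

For (i), a stationary field with this tail measure is obtained by drawing a radius `s > 1` and a
path `x`, replacing `x` by its periodisation with period `2 N(s) + 1`, and recentring uniformly over
one period; here `N(s) → ∞` slowly enough for the total mass to stay finite.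

For (ii), the conditional limits are self-similar, so that every tail process `Y` has `|Y_0|`
independent of `Θ`; hence the law of `Y` is `c⁻¹` times the tail measure restricted to
`{|y_0| > 1}`. A function `F` whose sum over each orbit `{θ^k z}` is shift-invariant can then be
integrated orbit by orbit; `F = 1 / |e|` gives the extremal index and `F = h · 1{A = 0}` the
anchored law.
-/

namespace TailField

/-! ### The radial measure -/

section Radial

variable {α : ℝ}

/-- The measure `α r^{-α-1} dr` on `(0, ∞)`: the radial part of an `α`-homogeneous measure. Its
restriction to `(1, ∞)` is the Pareto distribution. -/
noncomputable def radialMeasure (α : ℝ) : Measure ℝ :=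
  (volume.restrict (Set.Ioi 0)).withDensity fun r => ENNReal.ofReal (α * r ^ (-(α + 1)))

instance : SFinite (radialMeasure α) := by unfold radialMeasure; infer_instance

lemma lintegral_radialMeasure {g : ℝ → ℝ≥0∞} (hg : Measurable g) :
    ∫⁻ r, g r ∂(radialMeasure α) =
      ∫⁻ r in Set.Ioi 0, ENNReal.ofReal (α * r ^ (-(α + 1))) * g r :=
  lintegral_withDensity_eq_lintegral_mul _ (by fun_prop) hg

lemma ae_radialMeasure_pos : ∀ᵐ s ∂(radialMeasure α), 0 < s :=
  (withDensity_absolutelyContinuous _ _).ae_le (ae_restrict_mem measurableSet_Ioi)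

lemma map_mul_left_volume_Ioi {a : ℝ} (ha : 0 < a) :
    (volume.restrict (Set.Ioi (0 : ℝ))).map (a * ·) =
      ENNReal.ofReal a⁻¹ • volume.restrict (Set.Ioi 0) := by
  have preimage_Ioi : (a * ·) ⁻¹' Set.Ioi (0 : ℝ) = Set.Ioi 0 := by
    ext r
    simp [mul_pos_iff_of_pos_left ha]
  rw [← Measure.restrict_smul, ← abs_of_pos (inv_pos.2 ha), ← Real.map_volume_mul_left ha.ne',
    Measure.restrict_map (by fun_prop) measurableSet_Ioi, preimage_Ioi]

lemma lintegral_radialMeasure_comp_mul {a : ℝ} (ha : 0 < a) {g : ℝ → ℝ≥0∞} (hg : Measurable g) :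
    ∫⁻ s, g (a * s) ∂(radialMeasure α) = ENNReal.ofReal (a ^ α) * ∫⁻ s, g s ∂(radialMeasure α) := by
  have density_inv_mul : ∀ r ∈ Set.Ioi (0 : ℝ), ENNReal.ofReal (α * (a⁻¹ * r) ^ (-(α + 1))) =
      ENNReal.ofReal (a ^ (α + 1)) * ENNReal.ofReal (α * r ^ (-(α + 1))) := fun r hr => by
    rw [← ENNReal.ofReal_mul (by positivity), Real.mul_rpow (by positivity) (le_of_lt hr),
      Real.inv_rpow ha.le, Real.rpow_neg ha.le, inv_inv]
    ring_nf
  calc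
    _ = ∫⁻ s in Set.Ioi 0,
          ENNReal.ofReal (α * (a⁻¹ * (a * s)) ^ (-(α + 1))) * g (a * s) := by
        rw [lintegral_radialMeasure (by fun_prop)]
        simp only [inv_mul_cancel_left₀ ha.ne']
    _ = ENNReal.ofReal a⁻¹ * ∫⁻ r in Set.Ioi 0,
          ENNReal.ofReal (α * (a⁻¹ * r) ^ (-(α + 1))) * g r := by
        rw [← smul_eq_mul, ← lintegral_smul_measure, ← map_mul_left_volume_Ioi ha,
          lintegral_map (by fun_prop) (by fun_prop)]
    _ = ENNReal.ofReal a⁻¹ * (ENNReal.ofReal (a ^ (α + 1)) * ∫⁻ s, g s ∂(radialMeasure α)) := by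
        rw [lintegral_radialMeasure hg,
          ← lintegral_const_mul (ENNReal.ofReal (a ^ (α + 1))) (by fun_prop)]
        congr 1
        refine setLIntegral_congr_fun measurableSet_Ioi fun r hr => ?_
        rw [density_inv_mul r hr, mul_assoc]
    _ = _ := by
        rw [← mul_assoc, ← ENNReal.ofReal_mul (by positivity), Real.rpow_add_one ha.ne',
          mul_left_comm, inv_mul_cancel₀ ha.ne', mul_one]

lemma map_mul_left_radialMeasure {a : ℝ} (ha : 0 < a) :
    (radialMeasure α).map (a * ·) = ENNReal.ofReal (a ^ α) • radialMeasure α := by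
  refine Measure.ext_of_lintegral _ fun g hg => ?_
  rw [lintegral_map hg (by fun_prop), lintegral_smul_measure,
    lintegral_radialMeasure_comp_mul ha hg, smul_eq_mul]

lemma radialMeasure_Ioi (hα : 0 < α) {t : ℝ} (ht : 0 < t) :
    radialMeasure α (Set.Ioi t) = ENNReal.ofReal (t ^ (-α)) := by
  have nonneg : 0 ≤ᵐ[volume.restrict (Set.Ioi t)] fun r => α * r ^ (-(α + 1)) := by
    filter_upwards [ae_restrict_mem measurableSet_Ioi] with r hr
    have : 0 < r := ht.trans hr
    simp only [Pi.zero_apply]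
    positivity
  rw [radialMeasure, withDensity_apply _ measurableSet_Ioi,
    Measure.restrict_restrict measurableSet_Ioi, Set.Ioi_inter_Ioi, sup_of_le_left ht.le,
    ← ofReal_integral_eq_lintegral_ofReal
      ((integrableOn_Ioi_rpow_of_lt (by linarith) ht).const_mul α) nonneg,
    integral_const_mul, integral_Ioi_rpow_of_lt (by linarith) ht, neg_add, neg_add_cancel_right]
  field_simp

lemma radialMeasure_one_lt_mul (hα : 0 < α) {b : ℝ} (hb : 0 ≤ b) :
    radialMeasure α {s | 1 < s * b} = ENNReal.ofReal (b ^ α) := by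
  rcases hb.eq_or_lt with rfl | hb
  · simp [Real.zero_rpow hα.ne', not_lt.2 zero_le_one]
  · have : {s : ℝ | 1 < s * b} = Set.Ioi b⁻¹ := by
      ext s
      exact (inv_lt_iff_one_lt_mul₀ hb).symm
    rw [this, radialMeasure_Ioi hα (inv_pos.2 hb), Real.inv_rpow hb.le, Real.rpow_neg hb.le,
      inv_inv]

lemma setLIntegral_radialMeasure_rpow_lt_top {b : ℝ} (hb : b < α) :
    ∫⁻ s in Set.Ioi 1, ENNReal.ofReal (s ^ b) ∂(radialMeasure α) < ∞ := by
  rw [radialMeasure, restrict_withDensity measurableSet_Ioi,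
    Measure.restrict_restrict measurableSet_Ioi, Set.Ioi_inter_Ioi, sup_of_le_left zero_le_one,
    lintegral_withDensity_eq_lintegral_mul _ (by fun_prop) (by fun_prop)]
  calc
    _ = ∫⁻ s in Set.Ioi 1, ENNReal.ofReal (α * s ^ (b - α - 1)) := by
        refine setLIntegral_congr_fun measurableSet_Ioi fun s hs => ?_
        have : 0 < s := one_pos.trans hs
        rw [Pi.mul_apply, ← ENNReal.ofReal_mul' (by positivity), mul_assoc, ← Real.rpow_add this]
        ring_nf
    _ < ∞ := ((integrableOn_Ioi_rpow_of_lt (by linarith) one_pos).const_mul α).lintegral_lt_top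

lemma paretoMeasure_eq_restrict_radialMeasure :
    paretoMeasure 1 α = (radialMeasure α).restrict (Set.Ioi 1) := by
  rw [radialMeasure, restrict_withDensity measurableSet_Ioi,
    Measure.restrict_restrict measurableSet_Ioi, Set.Ioi_inter_Ioi, sup_of_le_left zero_le_one,
    restrict_Ioi_eq_restrict_Ici, ← withDensity_indicator measurableSet_Ici, paretoMeasure]
  congr 1
  ext r
  by_cases hr : 1 ≤ r
  · simp [Set.indicator_of_mem (show r ∈ Set.Ici (1 : ℝ) from hr), paretoPDF_of_le hr]
  · rw [Set.indicator_of_notMem (by simpa using hr), paretoPDF_of_lt (not_le.1 hr)]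

lemma ae_paretoMeasure_one_lt : ∀ᵐ r ∂(paretoMeasure 1 α), 1 < r := by
  rw [paretoMeasure_eq_restrict_radialMeasure]
  exact ae_restrict_mem measurableSet_Ioi

instance : SFinite (paretoMeasure 1 α) := by
  rw [paretoMeasure_eq_restrict_radialMeasure]
  infer_instance

end Radial

/-! ### Paths, shifts and exceedances -/

section Paths

variable {d : ℕ}

@[fun_prop]
lemma measurable_shift (k : Lattice d) : Measurable (shift k : Path d → Path d) := by
  unfold shift
  fun_prop

@[fun_prop]
lemma measurable_eval_prod : Measurable fun p : Path d × Lattice d => p.1 p.2 :=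
  measurable_from_prod_countable_left fun i => measurable_pi_apply i

lemma shift_shift (j k : Lattice d) (x : Path d) : shift j (shift k x) = shift (j + k) x := by
  funext i
  simp [shift, add_assoc]

@[fun_prop]
lemma measurable_spectral : Measurable (spectral : Path d → Path d) := by
  unfold spectral
  fun_prop

lemma spectral_smul {s : ℝ} (hs : 0 < s) (y : Path d) : spectral (s • y) = spectral y := by
  funext i
  simp only [spectral, Pi.smul_apply, smul_eq_mul, abs_mul, abs_of_pos hs]
  field_simp

lemma spectral_eq_self {y : Path d} (hy : |y 0| = 1) : spectral y = y := by
  funext i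
  simp [spectral, hy]

lemma abs_smul_spectral {y : Path d} (hy : y 0 ≠ 0) : |y 0| • spectral y = y := by
  funext i
  simp [spectral, abs_ne_zero.2 hy]

/-- The paths exceeding the level `u` at the origin: the events on which fields are conditioned in
the definition of the tail process. -/
def originExceeds (d : ℕ) (u : ℝ) : Set (Path d) := {x | u < |x 0|}

lemma measurableSet_originExceeds (u : ℝ) : MeasurableSet (originExceeds d u) :=
  measurableSet_lt (by fun_prop) (by fun_prop)

lemma mem_originExceeds_congr {u : ℝ} {x y : Path d} (h : x 0 = y 0) :
    x ∈ originExceeds d u ↔ y ∈ originExceeds d u := by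
  simp [originExceeds, h]

lemma originExceeds_anti : Antitone (originExceeds d) := fun _ _ huv _ hx => huv.trans_lt hx

lemma smul_mem_originExceeds {a : ℝ} (ha : 0 < a) {u : ℝ} {x : Path d} :
    a • x ∈ originExceeds d (a * u) ↔ x ∈ originExceeds d u := by
  simp [originExceeds, abs_mul, abs_of_pos ha, ha]

lemma shift_mem_originExceeds {k : Lattice d} {x : Path d} :
    shift k x ∈ originExceeds d 1 ↔ k ∈ exceedances x := by
  simp [originExceeds, exceedances, shift]

lemma encard_exceedances_shift (k : Lattice d) (x : Path d) :
    (exceedances (shift k x)).encard = (exceedances x).encard :=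
  Set.encard_preimage_of_bijective (Equiv.addRight k).bijective (exceedances x)

lemma shift_mem_E0 {k : Lattice d} {x : Path d} :
    shift k x ∈ E0 d ↔ k ∈ exceedances x ∧ (exceedances x).Finite := by
  rw [← Set.encard_lt_top_iff (s := exceedances x), ← encard_exceedances_shift k x,
    Set.encard_lt_top_iff, ← shift_mem_originExceeds]
  rfl

lemma measurableSet_mem_exceedances (k : Lattice d) :
    MeasurableSet {x : Path d | k ∈ exceedances x} :=
  measurableSet_lt (g := fun x : Path d => |x k|) measurable_const (by fun_prop)

lemma measurable_encard_exceedances :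
    Measurable fun x : Path d => ((exceedances x).encard : ℝ≥0∞) := by
  simp only [← ENNReal.tsum_set_one, tsum_subtype (exceedances _) fun _ => (1 : ℝ≥0∞)]
  exact Measurable.tsum fun k => measurable_one.indicator (measurableSet_mem_exceedances k)

lemma measurableSet_E0 : MeasurableSet (E0 d) := by
  have finite_iff : ∀ x : Path d, (exceedances x).Finite ↔ ((exceedances x).encard : ℝ≥0∞) < ∞ := by
    simp [lt_top_iff_ne_top]
  simp only [E0, finite_iff]
  exact (measurableSet_originExceeds 1).inter
    (measurableSet_lt measurable_encard_exceedances measurable_const)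

lemma measurableSet_l0 : MeasurableSet (l0 d) := by
  have : (cofinite : Filter (Lattice d)).IsCountablyGenerated :=
    HasCountableBasis.isCountablyGenerated ⟨hasBasis_cofinite, Set.Countable.ofPred_finite⟩
  exact measurableSet_tendsto _ fun i => by fun_prop

lemma smul_mem_l0 {x : Path d} (hx : x ∈ l0 d) (s : ℝ) : s • x ∈ l0 d := by
  have : Tendsto (fun i => |s| * |x i|) cofinite (𝓝 0) := by
    simpa using Tendsto.const_mul |s| hx
  exact this.congr fun i => by simp [abs_mul]

lemma finite_exceedances {x : Path d} (hx : x ∈ l0 d) : (exceedances x).Finite :=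
  (eventually_cofinite.1 (Tendsto.eventually_lt_const one_pos hx)).subset fun _ hi => hi.not_gt

end Paths

/-! ### The uniform norm -/

section SupNorm

variable {d : ℕ}

lemma supNorm_nonneg (x : Path d) : 0 ≤ supNorm x := Real.iSup_nonneg fun _ => abs_nonneg _

lemma supNorm_smul (s : ℝ) (x : Path d) : supNorm (s • x) = |s| * supNorm x := by
  simp only [supNorm, Pi.smul_apply, smul_eq_mul, abs_mul]
  exact (Real.mul_iSup_of_nonneg (abs_nonneg s) _).symm

lemma supNorm_shift (k : Lattice d) (x : Path d) : supNorm (shift k x) = supNorm x :=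
  (Equiv.addRight k).iSup_comp (g := fun i => |x i|)

@[fun_prop]
lemma measurable_supNorm : Measurable (supNorm : Path d → ℝ) :=
  Measurable.iSup fun i => by fun_prop

lemma one_lt_supNorm_iff {x : Path d} (hx : x ∈ l0 d) :
    1 < supNorm x ↔ (exceedances x).Nonempty :=
  lt_ciSup_iff (Tendsto.bddAbove_range_of_cofinite hx)

/-- The path `x / ‖x‖`, which sends an anchored process to its spectral counterpart; it is `0` when
`‖x‖ = 0`. -/
noncomputable def normalize (x : Path d) : Path d := (supNorm x)⁻¹ • x

@[fun_prop]
lemma measurable_normalize : Measurable (normalize : Path d → Path d) := by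
  unfold normalize
  fun_prop

lemma normalize_smul {s : ℝ} (hs : 0 < s) (x : Path d) : normalize (s • x) = normalize x := by
  rw [normalize, supNorm_smul, abs_of_pos hs, smul_smul, mul_inv_rev, inv_mul_cancel_right₀ hs.ne',
    normalize]

lemma normalize_shift (k : Lattice d) (x : Path d) :
    normalize (shift k x) = shift k (normalize x) := by
  rw [normalize, supNorm_shift]
  rfl

end SupNorm

/-! ### Tail measures and their polar decompositions -/

section TailMeasure

variable {d : ℕ} {α : ℝ} {π : Measure (Path d)}

/-- The intensity of the triples `(x, s, k)` from which a moving average with coefficients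
distributed as `π` is assembled: a coefficient path `x`, a radius `s` and a location `k`. -/
noncomputable def clusterMeasure (π : Measure (Path d)) (α : ℝ) :
    Measure (Path d × ℝ × Lattice d) :=
  π.prod ((radialMeasure α).prod Measure.count)

/-- The cluster `s θ^k x` contributed by the triple `(x, s, k)`. -/
def cluster (p : Path d × ℝ × Lattice d) : Path d := p.2.1 • shift p.2.2 p.1

/-- The tail measure with coefficient law `π`: the shift-invariant, `α`-homogeneous measure
`B ↦ ∑_k ∫ π(s θ^k x ∈ B) α s^{-α-1} ds`, whose restriction to the paths exceeding `1` at the origin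
is proportional to the law of the tail process. -/
noncomputable def tailMeasure (π : Measure (Path d)) (α : ℝ) : Measure (Path d) :=
  (clusterMeasure π α).map cluster

/-- The angular part of the tail measure with respect to the modulus `|y_0|`, not normalised:
`B ↦ ∑_k ∫ 1{θ^k x / |x_k| ∈ B} |x_k|^α π(dx)`. -/
noncomputable def spectralMeasure (π : Measure (Path d)) (α : ℝ) : Measure (Path d) :=
  Measure.sum fun k =>
    (π.withDensity fun x => ENNReal.ofReal (|x k| ^ α)).map fun x => spectral (shift k x)

/-- The angular part of the tail measure with respect to `‖x‖` and modulo shifts, not normalised: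
`B ↦ ∫ 1{x / ‖x‖ ∈ B} ‖x‖^α π(dx)`. -/
noncomputable def anchoredSpectralMeasure (π : Measure (Path d)) (α : ℝ) : Measure (Path d) :=
  (π.withDensity fun x => ENNReal.ofReal (supNorm x ^ α)).map normalize

/-- The law of `ρ Θ`, where `ρ` is `Pareto(α)`-distributed and independent of `Θ` with law `μ`. -/
noncomputable def paretoMixture (α : ℝ) (μ : Measure (Path d)) : Measure (Path d) :=
  ((paretoMeasure 1 α).prod μ).map fun p => p.1 • p.2

@[fun_prop]
lemma measurable_cluster : Measurable (cluster : Path d × ℝ × Lattice d → Path d) := by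
  refine measurable_pi_lambda _ fun i => ?_
  exact (measurable_fst.comp measurable_snd).mul
    (measurable_eval_prod.comp (f := fun p : Path d × ℝ × Lattice d => (p.1, i + p.2.2))
      (by fun_prop))

lemma cluster_apply_zero (x : Path d) (s : ℝ) (k : Lattice d) : cluster (x, s, k) 0 = s * x k := by
  simp [cluster, shift]

lemma lintegral_clusterMeasure {F : Path d × ℝ × Lattice d → ℝ≥0∞} (hF : Measurable F) :
    ∫⁻ p, F p ∂(clusterMeasure π α) =
      ∫⁻ x, ∫⁻ s, ∑' k, F (x, s, k) ∂(radialMeasure α) ∂π := by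
  rw [clusterMeasure, lintegral_prod _ hF.aemeasurable]
  refine lintegral_congr fun x => ?_
  have hFx : Measurable fun q : ℝ × Lattice d => F (x, q) := by fun_prop
  simp only [lintegral_prod _ hFx.aemeasurable, lintegral_count]

lemma lintegral_tailMeasure {F : Path d → ℝ≥0∞} (hF : Measurable F) :
    ∫⁻ y, F y ∂(tailMeasure π α) =
      ∫⁻ x, ∫⁻ s, ∑' k, F (s • shift k x) ∂(radialMeasure α) ∂π := by
  rw [tailMeasure, lintegral_map hF measurable_cluster, lintegral_clusterMeasure (by fun_prop)]
  rfl

lemma lintegral_spectralMeasure {F : Path d → ℝ≥0∞} (hF : Measurable F) :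
    ∫⁻ y, F y ∂(spectralMeasure π α) =
      ∑' k, ∫⁻ x, ENNReal.ofReal (|x k| ^ α) * F (spectral (shift k x)) ∂π := by
  rw [spectralMeasure, lintegral_sum_measure]
  refine tsum_congr fun k => ?_
  rw [lintegral_map hF (by fun_prop),
    lintegral_withDensity_eq_lintegral_mul _ (by fun_prop) (by fun_prop)]
  rfl

lemma lintegral_anchoredSpectralMeasure {F : Path d → ℝ≥0∞} (hF : Measurable F) :
    ∫⁻ y, F y ∂(anchoredSpectralMeasure π α) =
      ∫⁻ x, ENNReal.ofReal (supNorm x ^ α) * F (normalize x) ∂π := by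
  rw [anchoredSpectralMeasure, lintegral_map hF (by fun_prop),
    lintegral_withDensity_eq_lintegral_mul _ (by fun_prop) (by fun_prop)]
  rfl

lemma lintegral_paretoMixture {μ : Measure (Path d)} [SFinite μ] {F : Path d → ℝ≥0∞}
    (hF : Measurable F) :
    ∫⁻ y, F y ∂(paretoMixture α μ) = ∫⁻ y, ∫⁻ r, F (r • y) ∂(paretoMeasure 1 α) ∂μ := by
  have hFsmul : Measurable fun p : ℝ × Path d => F (p.1 • p.2) := by fun_prop
  rw [paretoMixture, lintegral_map hF (by fun_prop), lintegral_prod_symm _ hFsmul.aemeasurable]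

instance [SFinite π] : SFinite (spectralMeasure π α) := by
  unfold spectralMeasure
  infer_instance

lemma paretoMixture_smul (a : ℝ≥0∞) (μ : Measure (Path d)) [SFinite μ] :
    paretoMixture α (a • μ) = a • paretoMixture α μ := by
  rw [paretoMixture, Measure.prod_smul_right, Measure.map_smul, paretoMixture]

lemma paretoMixture_univ (hα : 0 < α) (μ : Measure (Path d)) [SFinite μ] :
    paretoMixture α μ Set.univ = μ Set.univ := by
  have := isProbabilityMeasure_paretoMeasure one_pos hα
  rw [paretoMixture, Measure.map_apply (by fun_prop) .univ, Set.preimage_univ,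
    ← Set.univ_prod_univ, Measure.prod_prod, measure_univ, one_mul]

lemma isProbabilityMeasure_paretoMixture (hα : 0 < α) (μ : Measure (Path d))
    [IsProbabilityMeasure μ] : IsProbabilityMeasure (paretoMixture α μ) :=
  ⟨by rw [paretoMixture_univ hα, measure_univ]⟩

lemma map_spectral_paretoMixture (hα : 0 < α) {μ : Measure (Path d)} [SFinite μ]
    (hμ : ∀ᵐ y ∂μ, |y 0| = 1) : (paretoMixture α μ).map spectral = μ := by
  have := isProbabilityMeasure_paretoMeasure one_pos hα
  have spectral_eq_snd : spectral ∘ (fun p : ℝ × Path d => p.1 • p.2)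
      =ᵐ[(paretoMeasure 1 α).prod μ] Prod.snd := by
    filter_upwards [Measure.quasiMeasurePreserving_fst.ae ae_paretoMeasure_one_lt,
      Measure.quasiMeasurePreserving_snd.ae hμ] with p hr hy
    rw [Function.comp_apply, spectral_smul (one_pos.trans hr), spectral_eq_self hy]
  rw [paretoMixture, Measure.map_map (by fun_prop) (by fun_prop), Measure.map_congr spectral_eq_snd,
    Measure.map_snd_prod, measure_univ, one_smul]

lemma map_abs_paretoMixture (α : ℝ) {μ : Measure (Path d)} [IsProbabilityMeasure μ]
    (hμ : ∀ᵐ y ∂μ, |y 0| = 1) : (paretoMixture α μ).map (fun y => |y 0|) = paretoMeasure 1 α := by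
  have abs_eq_fst : (fun y : Path d => |y 0|) ∘ (fun p : ℝ × Path d => p.1 • p.2)
      =ᵐ[(paretoMeasure 1 α).prod μ] Prod.fst := by
    filter_upwards [Measure.quasiMeasurePreserving_fst.ae ae_paretoMeasure_one_lt,
      Measure.quasiMeasurePreserving_snd.ae hμ] with p hr hy
    simp [abs_mul, hy, abs_of_pos (one_pos.trans hr)]
  rw [paretoMixture, Measure.map_map (by fun_prop) (by fun_prop), Measure.map_congr abs_eq_fst,
    Measure.map_fst_prod, measure_univ, one_smul]

lemma lintegral_radialMeasure_ray (hα : 0 < α) {F : Path d → ℝ≥0∞} (hF : Measurable F)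
    (y : Path d) :
    ∫⁻ s, (originExceeds d 1).indicator F (s • y) ∂(radialMeasure α) =
      ENNReal.ofReal (|y 0| ^ α) * ∫⁻ r, F (r • spectral y) ∂(paretoMeasure 1 α) := by
  by_cases hy : y 0 = 0
  · have notMem : ∀ s : ℝ, s • y ∉ originExceeds d 1 := by simp [originExceeds, hy]
    simp [Set.indicator_of_notMem (notMem _), hy, Real.zero_rpow hα.ne']
  · have hF' : Measurable fun r : ℝ => F (r • spectral y) := by fun_prop
    rw [paretoMeasure_eq_restrict_radialMeasure, ← lintegral_indicator measurableSet_Ioi,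
      ← lintegral_radialMeasure_comp_mul (abs_pos.2 hy) (hF'.indicator measurableSet_Ioi)]
    refine lintegral_congr_ae ?_
    filter_upwards [ae_radialMeasure_pos] with s hs
    have mem_iff : s • y ∈ originExceeds d 1 ↔ s * |y 0| ∈ Set.Ioi 1 := by
      simp [originExceeds, abs_mul, abs_of_pos hs]
    rw [mul_comm |y 0|]
    by_cases h : s • y ∈ originExceeds d 1
    · rw [Set.indicator_of_mem h, Set.indicator_of_mem (mem_iff.1 h), mul_smul,
        abs_smul_spectral hy]
    · rw [Set.indicator_of_notMem h, Set.indicator_of_notMem (mt mem_iff.2 h)]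

lemma restrict_tailMeasure [SFinite π] (hα : 0 < α) :
    (tailMeasure π α).restrict (originExceeds d 1) = paretoMixture α (spectralMeasure π α) := by
  refine Measure.ext_of_lintegral _ fun F hF => ?_
  have hF' := hF.indicator (measurableSet_originExceeds (d := d) 1)
  have hFr : Measurable fun y : Path d => ∫⁻ r, F (r • y) ∂(paretoMeasure 1 α) :=
    Measurable.lintegral_prod_right' (f := fun p : Path d × ℝ => F (p.2 • p.1)) (by fun_prop)
  rw [← lintegral_indicator (measurableSet_originExceeds 1), lintegral_tailMeasure hF',
    lintegral_paretoMixture hF, lintegral_spectralMeasure hFr]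
  calc
    _ = ∫⁻ x, ∑' k, ∫⁻ s, (originExceeds d 1).indicator F (s • shift k x) ∂(radialMeasure α) ∂π :=
        lintegral_congr fun x => lintegral_tsum fun k => by fun_prop
    _ = ∫⁻ x, ∑' k, ENNReal.ofReal (|x k| ^ α) *
          ∫⁻ r, F (r • spectral (shift k x)) ∂(paretoMeasure 1 α) ∂π := by
        simp only [lintegral_radialMeasure_ray hα hF, shift, zero_add]
    _ = _ := lintegral_tsum fun k => by fun_prop

lemma ae_spectralMeasure_abs_eq_one (hα : 0 < α) : ∀ᵐ y ∂(spectralMeasure π α), |y 0| = 1 := by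
  have hm : MeasurableSet {y : Path d | |y 0| = 1} :=
    measurableSet_eq_fun (by fun_prop) (by fun_prop)
  refine Measure.ae_sum_iff' hm |>.2 fun k => ?_
  rw [ae_map_iff (by fun_prop) hm, ae_withDensity_iff (by fun_prop)]
  refine ae_of_all _ fun x hx => ?_
  have : x k ≠ 0 := by
    rintro hk
    simp [hk, Real.zero_rpow hα.ne'] at hx
  simp [spectral, shift, abs_mul, this]

end TailMeasure

/-! ### Periodisation -/

section Periodisation

variable {d : ℕ}

/-- The hypercube `{-N,…,N}^d` as a finset, so that it can be counted and summed over. -/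
noncomputable def boxFinset (d N : ℕ) : Finset (Lattice d) :=
  Fintype.piFinset fun _ => Finset.Icc (-(N : ℤ)) N

/-- The representative of `i` in `{-N,…,N}^d` modulo `2N+1`. -/
def fold (N : ℕ) (i : Lattice d) : Lattice d := fun j => (i j).bmod (2 * N + 1)

/-- The `(2N+1)`-periodic path that agrees with `x` on `{-N,…,N}^d`. -/
def periodize (N : ℕ) (x : Path d) : Path d := fun i => x (fold N i)

lemma zero_mem_box (d m : ℕ) : (0 : Lattice d) ∈ box d m := fun j => by simp

lemma mem_boxFinset {N : ℕ} {i : Lattice d} : i ∈ boxFinset d N ↔ i ∈ box d N := by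
  simp [boxFinset, box, abs_le]

lemma card_boxFinset (d N : ℕ) : (boxFinset d N).card = (2 * N + 1) ^ d := by
  have : ((N : ℤ) + 1 + N).toNat = 2 * N + 1 := by omega
  simp [boxFinset, this]

lemma add_mem_boxFinset {M N : ℕ} {i k : Lattice d} (hi : i ∈ boxFinset d M)
    (hk : k ∈ boxFinset d N) : i + k ∈ boxFinset d (M + N) := by
  rw [mem_boxFinset] at *
  intro j
  push_cast
  exact (abs_add_le _ _).trans (add_le_add (hi j) (hk j))

lemma boxFinset_mono : Monotone (boxFinset d) := fun M N hMN i hi => by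
  rw [mem_boxFinset] at *
  exact fun j => (hi j).trans (by exact_mod_cast hMN)

lemma exists_mem_boxFinset (k : Lattice d) : ∃ N, k ∈ boxFinset d N := by
  refine ⟨∑ j, (k j).natAbs, mem_boxFinset.2 fun j => ?_⟩
  rw [← Int.natCast_natAbs]
  exact_mod_cast Finset.single_le_sum (f := fun j => (k j).natAbs) (fun _ _ => Nat.zero_le _)
    (Finset.mem_univ j)

lemma fold_mem_boxFinset (N : ℕ) (i : Lattice d) : fold N i ∈ boxFinset d N := by
  refine mem_boxFinset.2 fun j => abs_le.2 ?_
  have := Int.le_bmod (x := i j) (m := 2 * N + 1) (by omega)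
  have := Int.bmod_le (x := i j) (m := 2 * N + 1) (by omega)
  simp only [fold]
  omega

lemma fold_eq_self {N : ℕ} {i : Lattice d} (hi : i ∈ boxFinset d N) : fold N i = i := by
  funext j
  have := abs_le.1 (mem_boxFinset.1 hi j)
  exact Int.bmod_eq_of_le (by omega) (by omega)

lemma fold_add_fold (N : ℕ) (i k : Lattice d) : fold N (i + fold N k) = fold N (i + k) := by
  funext j
  simp [fold]

lemma periodize_apply {N : ℕ} {i : Lattice d} (hi : i ∈ boxFinset d N) (x : Path d) :
    periodize N x i = x i := by
  rw [periodize, fold_eq_self hi]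

lemma shift_fold_periodize (N : ℕ) (k : Lattice d) (x : Path d) :
    shift (fold N k) (periodize N x) = shift k (periodize N x) := by
  funext i
  simp only [shift, periodize, fold_add_fold]

lemma sum_boxFinset_fold_add {M : Type*} [AddCommMonoid M] (N : ℕ) (j : Lattice d)
    (f : Lattice d → M) : ∑ k ∈ boxFinset d N, f (fold N (j + k)) = ∑ k ∈ boxFinset d N, f k := by
  have fold_add_cancel : ∀ i, ∀ k ∈ boxFinset d N, fold N (-i + fold N (i + k)) = k :=
    fun i k hk => by rw [fold_add_fold, neg_add_cancel_left, fold_eq_self hk]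
  refine Finset.sum_nbij' (fun k => fold N (j + k)) (fun k => fold N (-j + k))
    (fun k _ => fold_mem_boxFinset N _) (fun k _ => fold_mem_boxFinset N _) (fold_add_cancel j)
    (fun k hk => ?_) (fun k _ => rfl)
  simpa using fold_add_cancel (-j) k hk

/-- The periodic counterpart of `cluster`: the coefficient path is first replaced by its
`(2N(s)+1)`-periodisation, where `s` is the radius. -/
def periodicCluster (N : ℝ → ℕ) (p : Path d × ℝ × Lattice d) : Path d :=
  cluster (periodize (N p.2.1) p.1, p.2.1, p.2.2)

/-- The triples `(x, s, k)` with radius `s` above `t` and location `k` in one period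
`{-N(s),…,N(s)}^d`. -/
def periodicParams (d : ℕ) (t : ℝ) (N : ℝ → ℕ) : Set (Path d × ℝ × Lattice d) :=
  {p | t < p.2.1 ∧ p.2.2 ∈ boxFinset d (N p.2.1)}

/-- The unnormalised law of a periodic field: a radius `s > t` is drawn from the radial measure, and
the `(2N(s)+1)`-periodic field with coefficients distributed as `π` is recentred uniformly over its
period. It is stationary, and finite if `N` grows slowly enough. -/
noncomputable def periodicLaw (π : Measure (Path d)) (α t : ℝ) (N : ℝ → ℕ) : Measure (Path d) :=
  ((clusterMeasure π α).restrict (periodicParams d t N)).map (periodicCluster N)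

variable {N : ℝ → ℕ} {π : Measure (Path d)} {α t : ℝ}

lemma measurable_periodicCluster (hN : Measurable N) :
    Measurable (periodicCluster N : Path d × ℝ × Lattice d → Path d) := by
  have hfold : ∀ i : Lattice d, Measurable fun n : ℕ => fold n i := fun _ => .of_discrete
  have : Measurable fun p : Path d × ℝ × Lattice d => periodize (N p.2.1) p.1 :=
    measurable_pi_lambda _ fun i => measurable_eval_prod.comp
      (measurable_fst.prodMk ((hfold i).comp (hN.comp (by fun_prop))))
  exact measurable_cluster.comp (by fun_prop)

lemma measurableSet_periodicParams (hN : Measurable N) : MeasurableSet (periodicParams d t N) := by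
  have hbox : MeasurableSet {q : Lattice d × ℕ | q.1 ∈ boxFinset d q.2} := .of_discrete
  have hmap : Measurable fun p : Path d × ℝ × Lattice d => (p.2.2, N p.2.1) := by fun_prop
  exact (measurableSet_lt (f := fun _ => t) (by fun_prop) (by fun_prop)).inter (hmap hbox)

lemma lintegral_periodicLaw (hN : Measurable N) {f : Path d → ℝ≥0∞} (hf : Measurable f) :
    ∫⁻ y, f y ∂(periodicLaw π α t N) =
      ∫⁻ x, ∫⁻ s in Set.Ioi t, ∑ k ∈ boxFinset d (N s), f (s • shift k (periodize (N s) x))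
        ∂(radialMeasure α) ∂π := by
  have hfp : Measurable fun p => f (periodicCluster (d := d) N p) :=
    hf.comp (measurable_periodicCluster hN)
  rw [periodicLaw, lintegral_map hf (measurable_periodicCluster hN),
    ← lintegral_indicator (measurableSet_periodicParams hN),
    lintegral_clusterMeasure (hfp.indicator (measurableSet_periodicParams hN))]
  refine lintegral_congr fun x => ?_
  rw [← lintegral_indicator measurableSet_Ioi]
  refine lintegral_congr fun s => ?_
  by_cases hs : s ∈ Set.Ioi t
  · rw [Set.indicator_of_mem hs, tsum_eq_sum (s := boxFinset d (N s))
      fun k hk => Set.indicator_of_notMem (fun hp => hk hp.2) _]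
    have mem : ∀ k ∈ boxFinset d (N s), (x, s, k) ∈ periodicParams d t N := fun k hk => ⟨hs, hk⟩
    exact Finset.sum_congr rfl fun k hk => Set.indicator_of_mem (mem k hk) _
  · rw [Set.indicator_of_notMem hs, ENNReal.tsum_eq_zero]
    exact fun k => Set.indicator_of_notMem (fun hp => hs hp.1) _

lemma isStationary_periodicLaw (hN : Measurable N) : IsStationary (periodicLaw π α t N) := by
  intro j
  refine Measure.ext_of_lintegral _ fun f hf => ?_
  rw [lintegral_map hf (measurable_shift j), lintegral_periodicLaw hN (by fun_prop),
    lintegral_periodicLaw hN hf]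
  refine lintegral_congr fun x => lintegral_congr fun s => ?_
  refine (Finset.sum_congr rfl fun k _ => ?_).trans (sum_boxFinset_fold_add (N s) j _)
  rw [shift_fold_periodize, ← shift_shift]
  rfl

lemma map_mul_radius_clusterMeasure [SFinite π] {u : ℝ} (hu : 0 < u) :
    (clusterMeasure π α).map (Prod.map id (Prod.map (u * ·) id)) =
      ENNReal.ofReal (u ^ α) • clusterMeasure π α := by
  rw [clusterMeasure, ← Measure.map_prod_map _ _ (by fun_prop) (by fun_prop),
    ← Measure.map_prod_map _ _ (by fun_prop) (by fun_prop), map_mul_left_radialMeasure hu,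
    Measure.map_id, Measure.map_id, Measure.prod_smul_left, Measure.prod_smul_right]

lemma map_smul_periodicLaw [SFinite π] (hN : Measurable N) {u : ℝ} (hu : 0 < u) :
    (periodicLaw π α (u⁻¹ * t) fun s => N (u * s)).map (u • ·) =
      ENNReal.ofReal (u ^ α) • periodicLaw π α t N := by
  let T : Path d × ℝ × Lattice d → Path d × ℝ × Lattice d := Prod.map id (Prod.map (u * ·) id)
  have hT : Measurable T := by fun_prop
  have hNu : Measurable fun s => N (u * s) := by fun_prop
  have preimage_params : T ⁻¹' periodicParams d t N =
      periodicParams d (u⁻¹ * t) fun s => N (u * s) := by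
    ext p
    exact and_congr_left' (inv_mul_lt_iff₀ hu).symm
  have cluster_comp : periodicCluster N ∘ T = (u • ·) ∘ periodicCluster fun s => N (u * s) := by
    funext p
    exact mul_smul _ _ _
  rw [periodicLaw, Measure.map_map (by fun_prop) (measurable_periodicCluster hNu), ← cluster_comp,
    ← preimage_params, ← Measure.map_map (measurable_periodicCluster hN) hT,
    ← Measure.restrict_map hT (measurableSet_periodicParams hN), map_mul_radius_clusterMeasure hu,
    Measure.restrict_smul, Measure.map_smul, periodicLaw]

lemma rpow_mul_integral_inv_smul_periodicLaw [SFinite π] (hN : Measurable N) {u : ℝ} (hu : 0 < u)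
    {G : Path d → ℝ} (hG : Measurable G) :
    u ^ α * ∫ x, G (u⁻¹ • x) ∂(periodicLaw π α t N) =
      ∫ y, G y ∂(periodicLaw π α (u⁻¹ * t) fun s => N (u * s)) := by
  have hGu : Measurable fun x => G (u⁻¹ • x) := by fun_prop
  rw [← smul_eq_mul, ← ENNReal.toReal_ofReal (show 0 ≤ u ^ α by positivity),
    ← integral_smul_measure, ← map_smul_periodicLaw hN hu,
    integral_map (by fun_prop) hGu.aestronglyMeasurable]
  simp only [inv_smul_smul₀ hu.ne']

end Periodisation

/-! ### The tail process of a periodised moving average -/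

section PeriodicTail

variable {d : ℕ} {π : Measure (Path d)} {α : ℝ}

lemma ae_clusterMeasure_radius_pos : ∀ᵐ p ∂(clusterMeasure π α), 0 < p.2.1 :=
  Measure.quasiMeasurePreserving_snd.ae (Measure.quasiMeasurePreserving_fst.ae ae_radialMeasure_pos)

lemma periodicCluster_apply_zero {N : ℝ → ℕ} {t : ℝ} {p : Path d × ℝ × Lattice d}
    (hp : p ∈ periodicParams d t N) : periodicCluster N p 0 = cluster p 0 := by
  rw [periodicCluster, cluster_apply_zero, cluster_apply_zero p.1, periodize_apply hp.2]

lemma eventually_periodicCluster_eq {ι : Type*} {l : Filter ι} {t : ι → ℝ} {N : ι → ℝ → ℕ}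
    (ht : Tendsto t l (𝓝 0)) {p : Path d × ℝ × Lattice d} (hp : 0 < p.2.1)
    (hN : Tendsto (fun i => N i p.2.1) l atTop) (m : ℕ) :
    ∀ᶠ i in l, p ∈ periodicParams d (t i) (N i) ∧
      ∀ j ∈ box d m, periodicCluster (N i) p j = cluster p j := by
  obtain ⟨K, hK⟩ := exists_mem_boxFinset p.2.2
  filter_upwards [ht.eventually_lt_const hp, hN.eventually_ge_atTop (m + K)] with i hti hNi
  refine ⟨⟨hti, boxFinset_mono (le_add_self.trans hNi) hK⟩, fun j hj => ?_⟩
  have hjk : j + p.2.2 ∈ boxFinset d (N i p.2.1) :=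
    boxFinset_mono hNi (add_mem_boxFinset (mem_boxFinset.2 hj) hK)
  simp only [periodicCluster, cluster, shift, Pi.smul_apply, periodize_apply hjk]

lemma tendsto_integral_periodicLaw {ι : Type*} {l : Filter ι} [l.IsCountablyGenerated]
    {t : ι → ℝ} {N : ι → ℝ → ℕ} (hNm : ∀ i, Measurable (N i)) (ht : Tendsto t l (𝓝 0))
    (hN : ∀ s, 0 < s → Tendsto (fun i => N i s) l atTop)
    (hfin : tailMeasure π α (originExceeds d 1) ≠ ∞) {G : Path d → ℝ} (hG : Measurable G)
    {b : ℝ} (hb : ∀ x, ‖G x‖ ≤ b) (hG0 : ∀ x ∉ originExceeds d 1, G x = 0) {m : ℕ}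
    (hGm : ∀ x y, (∀ i ∈ box d m, x i = y i) → G x = G y) :
    Tendsto (fun i => ∫ y, G y ∂(periodicLaw π α (t i) (N i))) l
      (𝓝 (∫ y, G y ∂(tailMeasure π α))) := by
  have hE := measurableSet_originExceeds (d := d) 1
  have hGN : ∀ i, Measurable fun p : Path d × ℝ × Lattice d => G (periodicCluster (N i) p) :=
    fun i => hG.comp (measurable_periodicCluster (hNm i))
  have integral_eq : ∀ i, ∫ y, G y ∂(periodicLaw π α (t i) (N i)) =
      ∫ p, (periodicParams d (t i) (N i)).indicator (fun p => G (periodicCluster (N i) p)) p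
        ∂(clusterMeasure π α) := fun i => by
    rw [periodicLaw, integral_map (measurable_periodicCluster (hNm i)).aemeasurable
      hG.aestronglyMeasurable, integral_indicator (measurableSet_periodicParams (hNm i))]
  simp only [integral_eq]
  rw [tailMeasure, integral_map measurable_cluster.aemeasurable hG.aestronglyMeasurable]
  refine tendsto_integral_filter_of_dominated_convergence
    (fun p => (originExceeds d 1).indicator (fun _ => b) (cluster p))
    (.of_forall fun i => ((hGN i).indicator
      (measurableSet_periodicParams (hNm i))).aestronglyMeasurable)
    (.of_forall fun i => ae_of_all _ fun p => ?dominated) ?integrable ?pointwise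
  case dominated =>
    by_cases hp : p ∈ periodicParams d (t i) (N i)
    · rw [Set.indicator_of_mem hp]
      by_cases hx : cluster p ∈ originExceeds d 1
      · rw [Set.indicator_of_mem hx]
        exact hb _
      · rw [Set.indicator_of_notMem hx, hG0 _ (by rwa [mem_originExceeds_congr
          (periodicCluster_apply_zero hp)]), norm_zero]
    · rw [Set.indicator_of_notMem hp, norm_zero]
      exact Set.indicator_nonneg (fun _ _ => (norm_nonneg _).trans (hb 0)) _
  case integrable =>
    refine (integrable_map_measure ?_ measurable_cluster.aemeasurable).1
      (IntegrableOn.integrable_indicator (integrableOn_const hfin) hE)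
    exact (measurable_const.indicator hE).aestronglyMeasurable
  case pointwise =>
    filter_upwards [ae_clusterMeasure_radius_pos] with p hp
    refine tendsto_const_nhds.congr' ?_
    filter_upwards [eventually_periodicCluster_eq ht hp (hN _ hp) m] with i hi
    rw [Set.indicator_of_mem hi.1, hGm _ _ hi.2]

lemma tendsto_rpow_mul_setIntegral_periodicLaw [SFinite π] {N : ℝ → ℕ} (hN : Measurable N)
    (hNt : Tendsto N atTop atTop) (hfin : tailMeasure π α (originExceeds d 1) ≠ ∞) (m : ℕ)
    (f : (box d m → ℝ) →ᵇ ℝ) :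
    Tendsto (fun u : ℝ => u ^ α * ∫ x in originExceeds d u, f (fun i => u⁻¹ * x i)
        ∂(periodicLaw π α 1 N)) atTop
      (𝓝 (∫ y in originExceeds d 1, f (fun i => y i) ∂(tailMeasure π α))) := by
  have hE := measurableSet_originExceeds (d := d)
  let G : Path d → ℝ := (originExceeds d 1).indicator fun y => f fun i => y i
  have hG : Measurable G := (f.continuous.measurable.comp (by fun_prop)).indicator (hE 1)
  have indicator_eq : ∀ u : ℝ, 0 < u → ((originExceeds d u).indicator fun x =>
      f fun i => u⁻¹ * x i) = fun x => G (u⁻¹ • x) := fun u hu => by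
    funext x
    have mem_iff : u⁻¹ • x ∈ originExceeds d 1 ↔ x ∈ originExceeds d u := by
      simpa [hu.ne'] using smul_mem_originExceeds (inv_pos.2 hu) (u := u) (x := x)
    by_cases hx : x ∈ originExceeds d u
    · simp [G, Set.indicator_of_mem hx, Set.indicator_of_mem (mem_iff.2 hx)]
    · simp [G, Set.indicator_of_notMem hx, Set.indicator_of_notMem (mt mem_iff.1 hx)]
  rw [← integral_indicator (hE 1)]
  suffices Tendsto (fun u : ℝ => ∫ y, G y ∂(periodicLaw π α (u⁻¹ * 1) fun s => N (u * s))) atTop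
      (𝓝 (∫ y, G y ∂(tailMeasure π α))) by
    refine this.congr' ?_
    filter_upwards [eventually_gt_atTop 0] with u hu
    rw [← integral_indicator (hE u), indicator_eq u hu,
      rpow_mul_integral_inv_smul_periodicLaw hN hu hG]
  refine tendsto_integral_periodicLaw (fun u => by fun_prop)
    (by simpa using tendsto_inv_atTop_zero (𝕜 := ℝ))
    (fun s hs => hNt.comp (tendsto_id.atTop_mul_const hs)) hfin hG (b := ‖f‖) (m := m)
    (fun x => (norm_indicator_le_norm_self _ _).trans (f.norm_coe_le_norm _))
    (fun x hx => Set.indicator_of_notMem hx _) fun x y hxy => ?_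
  have restrict_eq : (fun i : box d m => x i) = fun i : box d m => y i :=
    funext fun i => hxy i i.2
  have mem_iff : x ∈ originExceeds d 1 ↔ y ∈ originExceeds d 1 :=
    mem_originExceeds_congr (hxy 0 (zero_mem_box d m))
  by_cases hx : x ∈ originExceeds d 1
  · simp only [G, Set.indicator_of_mem hx, Set.indicator_of_mem (mem_iff.1 hx), restrict_eq]
  · simp only [G, Set.indicator_of_notMem hx, Set.indicator_of_notMem (mt mem_iff.2 hx)]

lemma cond_smul_measure {Ω : Type*} [MeasurableSpace Ω] {a : ℝ≥0∞} (ha0 : a ≠ 0) (ha : a ≠ ∞)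
    (μ : Measure Ω) (S : Set Ω) : cond (a • μ) S = cond μ S := by
  rw [ProbabilityTheory.cond, ProbabilityTheory.cond, Measure.restrict_smul, smul_smul,
    Measure.smul_apply, smul_eq_mul, ENNReal.mul_inv (.inl ha0) (.inl ha), mul_right_comm,
    ENNReal.inv_mul_cancel ha0 ha, one_mul]

lemma IsTailProcessOf.smul_measure {μX μY : Measure (Path d)} (h : IsTailProcessOf μX μY)
    {a : ℝ≥0∞} (ha0 : a ≠ 0) (ha : a ≠ ∞) : IsTailProcessOf (a • μX) μY where
  tail_pos u := ENNReal.mul_pos ha0 (h.tail_pos u).ne'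
  exceeds := h.exceeds
  tendsto m f := by simpa only [cond_smul_measure ha0 ha] using h.tendsto m f

lemma IsTailProcessOf.of_tendsto {μX μY : Measure (Path d)} [IsProbabilityMeasure μY] {b : ℝ → ℝ}
    {c : ℝ} (hc : c ≠ 0) (exceeds : ∀ᵐ y ∂μY, 1 < |y 0|)
    (tendsto : ∀ (m : ℕ) (f : (box d m → ℝ) →ᵇ ℝ),
      Tendsto (fun u => b u * ∫ x in originExceeds d u, f (fun i => u⁻¹ * x i) ∂μX) atTop
        (𝓝 (c * ∫ y, f (fun i => y i) ∂μY))) :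
    IsTailProcessOf μX μY := by
  have mass_tendsto : Tendsto (fun u => b u * μX.real (originExceeds d u)) atTop (𝓝 c) := by
    simpa using tendsto 0 (.const _ 1)
  have mass_ne_zero := mass_tendsto.eventually_ne hc
  refine ⟨fun u => ?_, exceeds, fun m f => ?_⟩
  · obtain ⟨v, hv, huv⟩ := (mass_ne_zero.and (eventually_ge_atTop u)).exists
    have : μX (originExceeds d v) ≠ 0 := fun h => hv (by simp [Measure.real, h])
    exact (pos_iff_ne_zero.2 this).trans_le (measure_mono (originExceeds_anti huv))
  · have ratio_tendsto := (tendsto m f).div mass_tendsto hc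
    rw [mul_div_cancel_left₀ _ hc] at ratio_tendsto
    refine ratio_tendsto.congr' ?_
    filter_upwards [mass_ne_zero] with u hu
    rw [ProbabilityTheory.cond, integral_smul_measure, ENNReal.toReal_inv, smul_eq_mul,
      Pi.div_apply, mul_div_mul_left _ _ (left_ne_zero_of_mul hu), div_eq_inv_mul]
    rfl

lemma exists_lintegral_card_boxFinset_lt_top (hα : 0 < α) (d : ℕ) :
    ∃ N : ℝ → ℕ, Measurable N ∧ Tendsto N atTop atTop ∧
      ∫⁻ s in Set.Ioi 1, ((boxFinset d (N s)).card : ℝ≥0∞) ∂(radialMeasure α) < ∞ := by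
  let β : ℝ := α / (2 * (d + 1))
  have hβ : 0 < β := by positivity
  have hβd : β * d < α := by
    rw [div_mul_eq_mul_div, div_lt_iff₀ (by positivity)]
    nlinarith [(Nat.cast_nonneg d : (0 : ℝ) ≤ d)]
  refine ⟨fun s => ⌊s ^ β⌋₊, Nat.measurable_floor.comp (by fun_prop),
    tendsto_nat_floor_atTop.comp (tendsto_rpow_atTop hβ), ?_⟩
  have card_le : ∀ s ∈ Set.Ioi (1 : ℝ), ((boxFinset d ⌊s ^ β⌋₊).card : ℝ≥0∞) ≤
      ENNReal.ofReal (3 ^ d) * ENNReal.ofReal (s ^ (β * d)) := fun s hs => by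
    have hs0 : 0 < s := one_pos.trans hs
    have one_le : 1 ≤ s ^ β := Real.one_le_rpow (le_of_lt hs) hβ.le
    have floor_le : (⌊s ^ β⌋₊ : ℝ) ≤ s ^ β := Nat.floor_le (by positivity)
    rw [card_boxFinset, ← ENNReal.ofReal_mul (by positivity), Real.rpow_mul_natCast hs0.le,
      ← mul_pow, ← ENNReal.ofReal_natCast]
    push_cast
    gcongr
    linarith
  calc
    _ ≤ ∫⁻ s in Set.Ioi 1, ENNReal.ofReal (3 ^ d) * ENNReal.ofReal (s ^ (β * d))
          ∂(radialMeasure α) := setLIntegral_mono (by fun_prop) card_le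
    _ < ∞ := by
        rw [lintegral_const_mul _ (by fun_prop)]
        exact ENNReal.mul_lt_top ENNReal.ofReal_lt_top (setLIntegral_radialMeasure_rpow_lt_top hβd)

lemma isFiniteMeasure_periodicLaw [IsFiniteMeasure π] {N : ℝ → ℕ} (hN : Measurable N) {t : ℝ}
    (hcard : ∫⁻ s in Set.Ioi t, ((boxFinset d (N s)).card : ℝ≥0∞) ∂(radialMeasure α) < ∞) :
    IsFiniteMeasure (periodicLaw π α t N) := by
  refine ⟨?_⟩
  rw [← lintegral_one, lintegral_periodicLaw hN measurable_const]
  simpa using ENNReal.mul_lt_top hcard (measure_lt_top π _)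

lemma ae_paretoMixture_one_lt {μ : Measure (Path d)} [IsProbabilityMeasure μ]
    (hμ : ∀ᵐ y ∂μ, |y 0| = 1) : ∀ᵐ y ∂(paretoMixture α μ), 1 < |y 0| := by
  have habs : Measurable fun y : Path d => |y 0| := by fun_prop
  refine ae_of_ae_map (p := fun r => 1 < r) habs.aemeasurable ?_
  rw [map_abs_paretoMixture α hμ]
  exact ae_paretoMeasure_one_lt

theorem isTailProcess_paretoMixture [IsFiniteMeasure π] (hα : 0 < α)
    (h0 : spectralMeasure π α Set.univ ≠ 0) (htop : spectralMeasure π α Set.univ ≠ ∞) :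
    IsTailProcess α
      (paretoMixture α ((spectralMeasure π α Set.univ)⁻¹ • spectralMeasure π α)) := by
  set c := spectralMeasure π α Set.univ
  have : IsProbabilityMeasure (c⁻¹ • spectralMeasure π α) :=
    ⟨by rw [Measure.smul_apply, smul_eq_mul, ENNReal.inv_mul_cancel h0 htop]⟩
  have := isProbabilityMeasure_paretoMixture hα (c⁻¹ • spectralMeasure π α)
  have abs_eq_one : ∀ᵐ y ∂(c⁻¹ • spectralMeasure π α), |y 0| = 1 :=
    Measure.ae_smul_measure (ae_spectralMeasure_abs_eq_one hα) _
  have restrict_eq : (tailMeasure π α).restrict (originExceeds d 1) =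
      c • paretoMixture α (c⁻¹ • spectralMeasure π α) := by
    rw [restrict_tailMeasure hα, paretoMixture_smul, smul_smul, ENNReal.mul_inv_cancel h0 htop,
      one_smul]
  have mass_ne_top : tailMeasure π α (originExceeds d 1) ≠ ∞ := by
    rwa [← Measure.restrict_apply_univ, restrict_tailMeasure hα, paretoMixture_univ hα]
  obtain ⟨N, hN, hNt, hcard⟩ := exists_lintegral_card_boxFinset_lt_top hα d
  let μX := periodicLaw π α 1 N
  have := isFiniteMeasure_periodicLaw (π := π) hN hcard
  have isTailProcessOf : IsTailProcessOf μX (paretoMixture α (c⁻¹ • spectralMeasure π α)) := by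
    refine .of_tendsto (b := fun u => u ^ α) (ENNReal.toReal_ne_zero.2 ⟨h0, htop⟩)
      (ae_paretoMixture_one_lt abs_eq_one) fun m f => ?_
    rw [← smul_eq_mul, ← integral_smul_measure, ← restrict_eq]
    exact tendsto_rpow_mul_setIntegral_periodicLaw hN hNt mass_ne_top m f
  have : NeZero μX := ⟨fun h => by simpa [h] using isTailProcessOf.tail_pos 0⟩
  refine ⟨(μX Set.univ)⁻¹ • μX, isProbabilityMeasureSMul, fun k => ?_,
    isTailProcessOf.smul_measure (by simp) (by simp [NeZero.ne]),
    map_abs_paretoMixture α abs_eq_one⟩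
  rw [Measure.map_smul, isStationary_periodicLaw hN k]

theorem isSpectralTailProcess_spectralMeasure [IsFiniteMeasure π] (hα : 0 < α)
    (h0 : spectralMeasure π α Set.univ ≠ 0) (htop : spectralMeasure π α Set.univ ≠ ∞) :
    IsSpectralTailProcess α ((spectralMeasure π α Set.univ)⁻¹ • spectralMeasure π α) := by
  have : IsProbabilityMeasure ((spectralMeasure π α Set.univ)⁻¹ • spectralMeasure π α) :=
    ⟨by rw [Measure.smul_apply, smul_eq_mul, ENNReal.inv_mul_cancel h0 htop]⟩
  refine ⟨_, isProbabilityMeasure_paretoMixture hα _, isTailProcess_paretoMixture hα h0 htop, ?_⟩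
  exact (map_spectral_paretoMixture hα
    (Measure.ae_smul_measure (ae_spectralMeasure_abs_eq_one hα) _)).symm

end PeriodicTail

/-! ### Independence of the modulus and the spectral tail process -/

section Independence

variable {E : Type*} [TopologicalSpace E] [HasOuterApproxClosed E]

lemma exists_boundedContinuous_tendsto_indicator {U : Set E} (hU : IsOpen U) :
    ∃ r : ℕ → E →ᵇ ℝ, (∀ n, ∀ z ∉ U, r n z = 0) ∧ (∀ n z, ‖r n z‖ ≤ 1) ∧
      ∀ z, Tendsto (fun n => r n z) atTop (𝓝 (U.indicator 1 z)) := by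
  let a := hU.isClosed_compl.apprSeq
  have norm_le : ∀ n z, ‖1 - (a n z : ℝ)‖ ≤ 1 := fun n z => by
    have := HasOuterApproxClosed.apprSeq_apply_le_one hU.isClosed_compl n z
    rw [Real.norm_of_nonneg (by simpa using this)]
    simp
  refine ⟨fun n => .ofNormedAddCommGroup (fun z => 1 - (a n z : ℝ)) (by fun_prop) 1 (norm_le n),
    fun n z hz => ?_, norm_le, fun z => ?_⟩
  · have := HasOuterApproxClosed.apprSeq_apply_eq_one hU.isClosed_compl n hz
    simp [a, this]
  · have := tendsto_pi_nhds.1 (HasOuterApproxClosed.tendsto_apprSeq hU.isClosed_compl) z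
    have := (NNReal.tendsto_coe.2 this).const_sub 1
    by_cases hz : z ∈ U <;> simpa [a, hz] using this

lemma smul_restrict_eq_smul_restrict_of_isOpen [MeasurableSpace E] [BorelSpace E]
    {μ ν : Measure E} [IsFiniteMeasure μ] [IsFiniteMeasure ν] {U : Set E} (hU : IsOpen U)
    (h : ∀ f g : E →ᵇ ℝ, (∀ z ∉ U, f z = 0) → (∀ z ∉ U, g z = 0) →
      (∫ z, f z ∂μ) * ∫ z, g z ∂ν = (∫ z, g z ∂μ) * ∫ z, f z ∂ν) :
    ν U • μ.restrict U = μ U • ν.restrict U := by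
  obtain ⟨r, r_eq_zero, norm_r_le, tendsto_r⟩ := exists_boundedContinuous_tendsto_indicator hU
  have tendsto_integral : ∀ (ρ : Measure E) [IsFiniteMeasure ρ] (f : E →ᵇ ℝ),
      Tendsto (fun n => ∫ z, (f * r n) z ∂ρ) atTop (𝓝 (∫ z in U, f z ∂ρ)) := fun ρ _ f => by
    rw [← integral_indicator hU.measurableSet]
    refine tendsto_integral_of_dominated_convergence (fun _ => ‖f‖)
      (fun n => (f * r n).continuous.aestronglyMeasurable) (integrable_const _)
      (fun n => ae_of_all _ fun z => ?_) (ae_of_all _ fun z => ?_)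
    · rw [BoundedContinuousFunction.mul_apply, norm_mul]
      simpa using mul_le_mul (f.norm_coe_le_norm z) (norm_r_le n z) (norm_nonneg _) (norm_nonneg _)
    · by_cases hz : z ∈ U <;> simpa [hz] using (tendsto_r z).const_mul (f z)
  have cross_eq : ∀ f g : E →ᵇ ℝ,
      (∫ z in U, f z ∂μ) * ∫ z in U, g z ∂ν = (∫ z in U, g z ∂μ) * ∫ z in U, f z ∂ν := fun f g => by
    have mul_r_eq_zero : ∀ (f : E →ᵇ ℝ) n, ∀ z ∉ U, (f * r n) z = 0 := fun f n z hz => by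
      rw [BoundedContinuousFunction.mul_apply, r_eq_zero n z hz, mul_zero]
    refine tendsto_nhds_unique ((tendsto_integral μ f).mul (tendsto_integral ν g)) ?_
    refine ((tendsto_integral μ g).mul (tendsto_integral ν f)).congr fun n => ?_
    exact (h _ _ (mul_r_eq_zero f n) (mul_r_eq_zero g n)).symm
  have : IsFiniteMeasure (ν U • μ.restrict U) := Measure.smul_finite _ (measure_ne_top ν U)
  have : IsFiniteMeasure (μ U • ν.restrict U) := Measure.smul_finite _ (measure_ne_top μ U)
  refine ext_of_forall_integral_eq_of_IsFiniteMeasure fun f => ?_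
  simpa [integral_smul_measure, mul_comm, Measure.real] using cross_eq f 1

lemma measure_eq_of_map_restrict_box_eq {d : ℕ} {μ ν : Measure (Path d)} [IsFiniteMeasure μ]
    (h : ∀ m, μ.map (box d m).domRestrict = ν.map (box d m).domRestrict) : μ = ν := by
  have map_restrict_eq : ∀ I : Finset (Lattice d), μ.map I.restrict = ν.map I.restrict := by
    intro I
    choose K hK using exists_mem_boxFinset (d := d)
    have hI : ∀ i : I, (i : Lattice d) ∈ box d (I.sup K) := fun i =>
      mem_boxFinset.1 (boxFinset_mono (Finset.le_sup i.2) (hK i))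
    let r : (box d (I.sup K) → ℝ) → I → ℝ := fun z i => z ⟨i, hI i⟩
    have hr : Measurable r := by fun_prop
    have restrict_eq : I.restrict = r ∘ (box d (I.sup K)).domRestrict (π := fun _ => ℝ) := rfl
    rw [restrict_eq, ← Measure.map_map hr (Set.measurable_restrict _), h,
      Measure.map_map hr (Set.measurable_restrict _)]
  exact IsProjectiveLimit.unique (P := fun I => μ.map I.restrict) (fun I => rfl)
    fun I => (map_restrict_eq I).symm

variable {d : ℕ} {α t : ℝ} {μX μY : Measure (Path d)}

lemma integral_cond_originExceeds (μ : Measure (Path d)) {u : ℝ} (hu : 0 < u) {m : ℕ}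
    {f : (box d m → ℝ) → ℝ} (hf : ∀ z, |z ⟨0, zero_mem_box d m⟩| ≤ 1 → f z = 0) :
    ∫ x, f (fun i => u⁻¹ * x i) ∂(cond μ (originExceeds d u)) =
      (μ.real (originExceeds d u))⁻¹ * ∫ x, f (fun i => u⁻¹ * x i) ∂μ := by
  rw [ProbabilityTheory.cond, integral_smul_measure, ENNReal.toReal_inv, smul_eq_mul,
    setIntegral_eq_integral_of_forall_compl_eq_zero fun x hx => hf _ ?_]
  · rfl
  · rw [abs_mul, abs_inv, abs_of_pos hu, inv_mul_le_iff₀ hu, mul_one]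
    exact not_lt.1 hx

/-- Conditioning on `|X_0| > u` and on `|X_0| > tu` gives the same integrals of `f(u⁻¹X)` up to a
factor independent of `f`, and these integrals tend to the two factors below. -/
lemma IsTailProcessOf.integral_mul_integral_smul_comm (h : IsTailProcessOf μX μY) (ht : 1 ≤ t)
    {m : ℕ} {f g : (box d m → ℝ) →ᵇ ℝ} (hf : ∀ z, |z ⟨0, zero_mem_box d m⟩| ≤ t → f z = 0)
    (hg : ∀ z, |z ⟨0, zero_mem_box d m⟩| ≤ t → g z = 0) :
    (∫ y, f (fun i => y i) ∂μY) * ∫ y, g (fun i => t * y i) ∂μY =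
      (∫ y, g (fun i => y i) ∂μY) * ∫ y, f (fun i => t * y i) ∂μY := by
  have ht0 : 0 < t := one_pos.trans_le ht
  let p : ℝ → ℝ := fun u => (μX.real (originExceeds d u))⁻¹
  let I : ((box d m → ℝ) →ᵇ ℝ) → ℝ → ℝ := fun f u => ∫ x, f (fun i => u⁻¹ * x i) ∂μX
  have tendsto_one : ∀ f : (box d m → ℝ) →ᵇ ℝ, (∀ z, |z ⟨0, zero_mem_box d m⟩| ≤ t → f z = 0) →
      Tendsto (fun u => p u * I f u) atTop (𝓝 (∫ y, f (fun i => y i) ∂μY)) := fun f hf =>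
    (h.tendsto m f).congr' <| (eventually_gt_atTop 0).mono fun u hu =>
      integral_cond_originExceeds μX hu fun z hz => hf z (hz.trans ht)
  have tendsto_smul : ∀ f : (box d m → ℝ) →ᵇ ℝ, (∀ z, |z ⟨0, zero_mem_box d m⟩| ≤ t → f z = 0) →
      Tendsto (fun u => p (t * u) * I f u) atTop (𝓝 (∫ y, f (fun i => t * y i) ∂μY)) := by
    intro f hf
    let ft : (box d m → ℝ) →ᵇ ℝ := f.compContinuous ⟨fun z i => t * z i, by fun_prop⟩
    have hft : ∀ z, |z ⟨0, zero_mem_box d m⟩| ≤ 1 → ft z = 0 := fun z hz => hf _ <| by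
      simpa [abs_mul, abs_of_pos ht0] using mul_le_mul_of_nonneg_left hz ht0.le
    refine ((h.tendsto m ft).comp (tendsto_id.const_mul_atTop ht0)).congr' ?_
    filter_upwards [eventually_gt_atTop 0] with u hu
    refine (integral_cond_originExceeds μX (mul_pos ht0 hu) hft).trans ?_
    simp only [ft, I, p, mul_inv, BoundedContinuousFunction.compContinuous_apply,
      ContinuousMap.coe_mk, mul_assoc, mul_inv_cancel_left₀ ht0.ne']
  refine tendsto_nhds_unique ((tendsto_one f hf).mul (tendsto_smul g hg)) ?_
  refine ((tendsto_one g hg).mul (tendsto_smul f hf)).congr fun u => ?_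
  ring

theorem IsTailProcessOf.restrict_originExceeds [IsProbabilityMeasure μY]
    (h : IsTailProcessOf μX μY) (ht : 1 ≤ t) :
    μY.restrict (originExceeds d t) = μY (originExceeds d t) • μY.map (t • ·) := by
  have ht0 : 0 < t := one_pos.trans_le ht
  refine measure_eq_of_map_restrict_box_eq fun m => ?_
  let ρ : Path d → box d m → ℝ := (box d m).domRestrict
  have hρ : Measurable ρ := Set.measurable_restrict _
  let U : Set (box d m → ℝ) := {z | t < |z ⟨0, zero_mem_box d m⟩|}
  have hU : IsOpen U := isOpen_lt (by fun_prop) (by fun_prop)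
  let ν : Measure (box d m → ℝ) := (μY.map (t • ·)).map ρ
  have : IsProbabilityMeasure ν := by
    have : IsProbabilityMeasure (μY.map (t • ·)) := Measure.isProbabilityMeasure_map (by fun_prop)
    exact Measure.isProbabilityMeasure_map hρ.aemeasurable
  have ae_mem : ∀ᵐ z ∂ν, z ∈ U := by
    refine (ae_map_iff hρ.aemeasurable hU.measurableSet).2
      ((ae_map_iff (by fun_prop) (hρ hU.measurableSet)).2 ?_)
    filter_upwards [h.exceeds] with y hy
    simpa [U, ρ, abs_mul, abs_of_pos ht0, ht0] using hy
  have : IsFiniteMeasure (μY.map ρ) := inferInstance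
  have key : ν U • (μY.map ρ).restrict U = (μY.map ρ) U • ν.restrict U := by
    refine smul_restrict_eq_smul_restrict_of_isOpen hU fun f g hf hg => ?_
    have integral_ν : ∀ f : (box d m → ℝ) →ᵇ ℝ,
        ∫ z, f z ∂ν = ∫ y, f (fun i => t * y i) ∂μY := fun f => by
      have hfρ : Measurable fun y => f (ρ y) := f.continuous.measurable.comp hρ
      exact (integral_map hρ.aemeasurable f.continuous.aestronglyMeasurable).trans
        (integral_map (by fun_prop) hfρ.aestronglyMeasurable)
    have integral_ρ : ∀ f : (box d m → ℝ) →ᵇ ℝ,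
        ∫ z, f z ∂(μY.map ρ) = ∫ y, f (fun i => y i) ∂μY := fun f =>
      integral_map hρ.aemeasurable f.continuous.aestronglyMeasurable
    rw [integral_ρ, integral_ρ, integral_ν, integral_ν]
    exact h.integral_mul_integral_smul_comm ht (fun z hz => hf z hz.not_gt)
      fun z hz => hg z hz.not_gt
  have hνU : ν U = 1 := (measure_congr (eventuallyEq_univ.2 ae_mem)).trans measure_univ
  rwa [hνU, one_smul, Measure.restrict_eq_self_of_ae_mem ae_mem,
    Measure.restrict_map hρ hU.measurableSet, Measure.map_apply hρ hU.measurableSet,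
    ← Measure.map_smul] at key

lemma IsTailProcessOf.restrict_originExceeds_apply_preimage_spectral [IsProbabilityMeasure μY]
    (h : IsTailProcessOf μX μY) (t : ℝ) {B : Set (Path d)} (hB : MeasurableSet B) :
    μY.restrict (originExceeds d t) (spectral ⁻¹' B) =
      μY (originExceeds d t) * μY (spectral ⁻¹' B) := by
  have hB' : MeasurableSet (spectral ⁻¹' B) := measurable_spectral hB
  rcases le_total 1 t with ht | ht
  · have preimage_eq : (t • ·) ⁻¹' (spectral ⁻¹' B) = spectral ⁻¹' B := by
      ext y
      rw [Set.mem_preimage, Set.mem_preimage, spectral_smul (one_pos.trans_le ht), Set.mem_preimage]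
    rw [h.restrict_originExceeds ht, Measure.smul_apply,
      Measure.map_apply (by fun_prop) hB', preimage_eq, smul_eq_mul]
  · have ae_mem : ∀ᵐ y ∂μY, y ∈ originExceeds d t := h.exceeds.mono fun y hy => ht.trans_lt hy
    have measure_eq_one : μY (originExceeds d t) = 1 :=
      (measure_congr (eventuallyEq_univ.2 ae_mem)).trans measure_univ
    rw [Measure.restrict_eq_self_of_ae_mem ae_mem, measure_eq_one, one_mul]

theorem IsTailProcessOf.indepFun_abs_spectral [IsProbabilityMeasure μY]
    (h : IsTailProcessOf μX μY) : IndepFun (fun y : Path d => |y 0|) spectral μY := by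
  have habs : Measurable fun y : Path d => |y 0| := by fun_prop
  refine indepFun_iff_measure_inter_preimage_eq_mul.2 fun A B hA hB => ?_
  have hB' : MeasurableSet (spectral ⁻¹' B) := measurable_spectral hB
  have map_eq : (μY.restrict (spectral ⁻¹' B)).map (fun y => |y 0|) =
      μY (spectral ⁻¹' B) • μY.map fun y => |y 0| := by
    refine ext_of_generate_finite (Set.range Set.Ioi)
      ((BorelSpace.measurable_eq (α := ℝ)).trans (borel_eq_generateFrom_Ioi ℝ)) isPiSystem_Ioi
      ?_ (by simp [Measure.map_apply habs .univ])
    rintro _ ⟨t, rfl⟩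
    have inter_eq := h.restrict_originExceeds_apply_preimage_spectral t hB
    rw [Measure.restrict_apply hB', Set.inter_comm, mul_comm] at inter_eq
    rwa [Measure.smul_apply, Measure.map_apply habs measurableSet_Ioi,
      Measure.map_apply habs measurableSet_Ioi, Measure.restrict_apply (habs measurableSet_Ioi)]
  have := DFunLike.congr_fun map_eq A
  rwa [Measure.smul_apply, Measure.map_apply habs hA, Measure.map_apply habs hA,
    Measure.restrict_apply (habs hA), smul_eq_mul, mul_comm] at this

lemma IsTailProcess.isProbabilityMeasure (hα : 0 < α) (h : IsTailProcess α μY) :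
    IsProbabilityMeasure μY := by
  obtain ⟨-, -, -, -, hpareto⟩ := h
  have := isProbabilityMeasure_paretoMeasure one_pos hα
  have habs : Measurable fun y : Path d => |y 0| := by fun_prop
  refine ⟨?_⟩
  rw [← Set.preimage_univ (f := fun y : Path d => |y 0|), ← Measure.map_apply habs .univ, hpareto,
    measure_univ]

theorem IsTailProcess.eq_paretoMixture (hα : 0 < α) (h : IsTailProcess α μY) :
    μY = paretoMixture α (μY.map spectral) := by
  have := h.isProbabilityMeasure hα
  obtain ⟨μX, -, -, hX, hpareto⟩ := h
  have habs : Measurable fun y : Path d => |y 0| := by fun_prop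
  have smul_spectral_ae : (fun y : Path d => |y 0| • spectral y) =ᵐ[μY] id := by
    filter_upwards [hX.exceeds] with y hy
    exact abs_smul_spectral (abs_pos.1 (one_pos.trans hy))
  rw [paretoMixture, ← hpareto, ← (indepFun_iff_map_prod_eq_prod_map_map habs.aemeasurable
    measurable_spectral.aemeasurable).1 hX.indepFun_abs_spectral,
    Measure.map_map (by fun_prop) (by fun_prop)]
  exact ((Measure.map_congr smul_spectral_ae).trans Measure.map_id).symm

end Independence

/-! ### Anchoring functions -/

section Anchoring

variable {d : ℕ} {A : Path d → Lattice d}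

/-- The paths with finitely many exceedances that the anchoring function `A` anchors at the origin:
the event on which `Y` is conditioned to give the anchored process. -/
def anchoredPaths (A : Path d → Lattice d) : Set (Path d) := {y | y ∈ E0 d ∧ A y = 0}

lemma IsAnchoring.measurableSet_anchoredPaths (hA : IsAnchoring A) :
    MeasurableSet (anchoredPaths A) := by
  have image_eq : anchoredPaths A = Subtype.val '' ((fun x : E0 d => A x) ⁻¹' {0}) :=
    Subtype.image_preimage_coe (E0 d) (A ⁻¹' {0}) |>.symm
  rw [image_eq]
  exact measurableSet_E0.subtype_image (hA.measurable (measurableSet_singleton _))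

lemma IsAnchoring.existsUnique_shift_mem_anchoredPaths (hA : IsAnchoring A) {z : Path d}
    (hfin : (exceedances z).Finite) (hne : (exceedances z).Nonempty) :
    ∃! k, shift k z ∈ anchoredPaths A := by
  obtain ⟨j, hj⟩ := hne
  have hjE : shift j z ∈ E0 d := shift_mem_E0.2 ⟨hj, hfin⟩
  have anchor_mem := hA.mem _ hjE
  refine ⟨A (shift j z) + j, ⟨shift_mem_E0.2 ⟨anchor_mem, hfin⟩, ?_⟩, fun k ⟨hkE, hk⟩ => ?_⟩
  · simpa [shift_shift] using hA.covariant _ hjE _ anchor_mem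
  · have mem_shift : k - j ∈ exceedances (shift j z) := by
      simpa [exceedances, shift] using (shift_mem_E0.1 hkE).1
    have := hA.covariant _ hjE _ mem_shift
    rw [shift_shift, sub_add_cancel, hk, zero_add] at this
    rw [← this, sub_add_cancel]

/-- The lexicographically least exceedance point of a path; it is arbitrary if there is none. -/
noncomputable def lexMinExceedance (x : Path d) : Lattice d :=
  Classical.epsilon fun k => k ∈ exceedances x ∧ ∀ j ∈ exceedances x, toLex k ≤ toLex j

lemma lexMinExceedance_eq_iff {x : Path d} (hx : x ∈ E0 d) {k : Lattice d} :
    lexMinExceedance x = k ↔ k ∈ exceedances x ∧ ∀ j ∈ exceedances x, toLex k ≤ toLex j := by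
  have spec : lexMinExceedance x ∈ exceedances x ∧
      ∀ j ∈ exceedances x, toLex (lexMinExceedance x) ≤ toLex j :=
    Classical.epsilon_spec (Set.exists_min_image (exceedances x) toLex hx.2 ⟨0, hx.1⟩)
  constructor
  · rintro rfl
    exact spec
  · exact fun hk => toLex.injective (le_antisymm (spec.2 k hk.1) (hk.2 _ spec.1))

theorem isAnchoring_lexMinExceedance (d : ℕ) : IsAnchoring (lexMinExceedance (d := d)) where
  measurable := measurable_to_countable' fun k => by
    have preimage_eq : (fun x : E0 d => lexMinExceedance (x : Path d)) ⁻¹' {k} =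
        Subtype.val ⁻¹' ({x : Path d | k ∈ exceedances x} ∩
          ⋂ j : {j : Lattice d // ¬ toLex k ≤ toLex j}, {x : Path d | j.1 ∈ exceedances x}ᶜ) := by
      ext x
      refine (lexMinExceedance_eq_iff x.2).trans (and_congr Iff.rfl ?_)
      simp only [Set.mem_iInter, Set.mem_compl_iff, Set.mem_ofPred_eq, Subtype.forall]
      exact forall_congr' fun j => not_imp_not.symm
    rw [preimage_eq]
    exact measurable_subtype_coe ((measurableSet_mem_exceedances k).inter
      (.iInter fun j => (measurableSet_mem_exceedances j.1).compl))
  mem x hx := ((lexMinExceedance_eq_iff hx).1 rfl).1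
  covariant x hx k hk := by
    have hkx : shift k x ∈ E0 d := shift_mem_E0.2 ⟨hk, hx.2⟩
    obtain ⟨mem, le⟩ := (lexMinExceedance_eq_iff hkx).1 rfl
    refine ((lexMinExceedance_eq_iff hx).2 ⟨mem, fun j hj => ?_⟩).symm
    have mem_shift : j - k ∈ exceedances (shift k x) := by simpa [exceedances, shift] using hj
    have := add_le_add_left (le _ mem_shift) (toLex k)
    rwa [← toLex_add, ← toLex_add, sub_add_cancel] at this

end Anchoring

/-! ### Orbit sums: the extremal index and the anchored law -/

section OrbitSums

variable {d : ℕ} {α : ℝ} {π : Measure (Path d)}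

lemma ae_mem_l0 (hα : 0 < α) (htop : spectralMeasure π α Set.univ ≠ ∞) :
    ∀ᵐ x ∂π, x ∈ l0 d := by
  have lintegral_ne_top : ∫⁻ x, ∑' k, ENNReal.ofReal (|x k| ^ α) ∂π ≠ ∞ := by
    have hm : ∀ k, Measurable fun x : Path d => ENNReal.ofReal (|x k| ^ α) := fun k => by fun_prop
    rw [lintegral_tsum fun k => (hm k).aemeasurable]
    simpa [← lintegral_one, lintegral_spectralMeasure measurable_const] using htop
  filter_upwards [ae_lt_top (by fun_prop) lintegral_ne_top] with x hx
  have tendsto_pow : Tendsto (fun k => |x k| ^ α) cofinite (𝓝 0) := by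
    have := (ENNReal.tendsto_toReal ENNReal.zero_ne_top).comp
      (ENNReal.tendsto_cofinite_zero_of_tsum_ne_top hx.ne)
    refine this.congr fun k => ENNReal.toReal_ofReal (by positivity)
  have := tendsto_pow.rpow_const (p := α⁻¹) (Or.inr (by positivity))
  rw [Real.zero_rpow (by positivity)] at this
  exact this.congr fun k => Real.rpow_rpow_inv (abs_nonneg _) hα.ne'

/-- Summing over the orbit of the path turns the tail measure into an integral over `s` and `x`
alone; as `∫ 1{s‖x‖ > 1} α s^{-α-1} ds = ‖x‖^α`, only the anchored angular part survives. -/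
theorem lintegral_paretoMixture_eq_lintegral_anchoredSpectralMeasure [SFinite π] (hα : 0 < α)
    (hπ : ∀ᵐ x ∂π, x ∈ l0 d) {F H : Path d → ℝ≥0∞} (hF : Measurable F) (hH : Measurable H)
    (tsum_eq : ∀ z ∈ l0 d, ∑' k, (originExceeds d 1).indicator F (shift k z) =
      {z | 1 < supNorm z}.indicator (fun z => H (normalize z)) z) :
    ∫⁻ y, F y ∂(paretoMixture α (spectralMeasure π α)) =
      ∫⁻ y, H y ∂(anchoredSpectralMeasure π α) := by
  have hE := measurableSet_originExceeds (d := d) 1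
  rw [← restrict_tailMeasure hα, ← lintegral_indicator hE, lintegral_tailMeasure (hF.indicator hE),
    lintegral_anchoredSpectralMeasure hH]
  refine lintegral_congr_ae ?_
  filter_upwards [hπ] with x hx
  have hm : MeasurableSet {s : ℝ | 1 < s * supNorm x} :=
    measurableSet_lt (by fun_prop) (by fun_prop)
  rw [← radialMeasure_one_lt_mul hα (supNorm_nonneg x), mul_comm, ← lintegral_indicator_const hm]
  refine lintegral_congr_ae ?_
  filter_upwards [ae_radialMeasure_pos] with s hs
  refine (tsum_eq (s • x) (smul_mem_l0 hx s)).trans ?_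
  simp only [Set.indicator_apply, Set.mem_ofPred_eq, supNorm_smul, abs_of_pos hs, normalize_smul hs]

lemma tsum_indicator_inv_encard_shift {z : Path d} (hz : z ∈ l0 d) :
    ∑' k, (originExceeds d 1).indicator (fun y => ((exceedances y).encard : ℝ≥0∞)⁻¹) (shift k z) =
      {z | 1 < supNorm z}.indicator 1 z := by
  have indicator_shift : ∀ k,
      (originExceeds d 1).indicator (fun y => ((exceedances y).encard : ℝ≥0∞)⁻¹) (shift k z) =
        (exceedances z).indicator (fun _ => 1) k * ((exceedances z).encard : ℝ≥0∞)⁻¹ := fun k => by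
    by_cases hk : k ∈ exceedances z
    · rw [Set.indicator_of_mem (shift_mem_originExceeds.2 hk), Set.indicator_of_mem hk, one_mul,
        encard_exceedances_shift]
    · rw [Set.indicator_of_notMem (mt shift_mem_originExceeds.1 hk), Set.indicator_of_notMem hk,
        zero_mul]
  simp only [indicator_shift]
  rw [ENNReal.tsum_mul_right, ← tsum_subtype, ENNReal.tsum_set_one]
  by_cases hne : (exceedances z).Nonempty
  · rw [Set.indicator_of_mem (s := {z | 1 < supNorm z}) ((one_lt_supNorm_iff hz).2 hne)]
    exact ENNReal.mul_inv_cancel (by simpa using hne.ne_empty)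
      (by simpa using finite_exceedances hz)
  · rw [Set.indicator_of_notMem (s := {z | 1 < supNorm z}) (mt (one_lt_supNorm_iff hz).1 hne),
      Set.not_nonempty_iff_eq_empty.1 hne]
    simp

lemma IsAnchoring.tsum_indicator_anchoredPaths_shift {A : Path d → Lattice d} (hA : IsAnchoring A)
    {h : Path d → ℝ≥0} (hh : ShiftInvariantOn h (l0 d)) {z : Path d} (hz : z ∈ l0 d) :
    ∑' k, (originExceeds d 1).indicator
        ((anchoredPaths A).indicator fun y => (h (normalize y) : ℝ≥0∞)) (shift k z) =
      {z | 1 < supNorm z}.indicator (fun z => (h (normalize z) : ℝ≥0∞)) z := by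
  have anchored_subset : anchoredPaths A ⊆ originExceeds d 1 := fun y hy => hy.1.1
  rw [Set.indicator_indicator, Set.inter_eq_self_of_subset_right anchored_subset]
  by_cases hne : (exceedances z).Nonempty
  · obtain ⟨k, hk, unique⟩ :=
      hA.existsUnique_shift_mem_anchoredPaths (finite_exceedances hz) hne
    rw [tsum_eq_single k fun j hj => Set.indicator_of_notMem (mt (unique j) hj) _,
      Set.indicator_of_mem hk,
      Set.indicator_of_mem (s := {z | 1 < supNorm z}) ((one_lt_supNorm_iff hz).2 hne),
      normalize_shift, hh (normalize z) (smul_mem_l0 hz _)]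
  · rw [Set.indicator_of_notMem (s := {z | 1 < supNorm z}) (mt (one_lt_supNorm_iff hz).1 hne)]
    exact ENNReal.tsum_eq_zero.2 fun k => Set.indicator_of_notMem
      (fun hk => hne ⟨k, shift_mem_originExceeds.1 (anchored_subset hk)⟩) _

theorem extremalIndex_paretoMixture_spectralMeasure [SFinite π] (hα : 0 < α)
    (hπ : ∀ᵐ x ∂π, x ∈ l0 d) :
    extremalIndex (paretoMixture α (spectralMeasure π α)) =
      anchoredSpectralMeasure π α Set.univ :=
  (lintegral_paretoMixture_eq_lintegral_anchoredSpectralMeasure hα hπ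
    measurable_encard_exceedances.inv measurable_one
    fun _ hz => tsum_indicator_inv_encard_shift hz).trans lintegral_one

lemma extremalIndex_smul (a : ℝ≥0∞) (μ : Measure (Path d)) :
    extremalIndex (a • μ) = a * extremalIndex μ :=
  lintegral_smul_measure a _

theorem IsAnchoring.representsAnchor_anchoredSpectralMeasure [SFinite π] {A : Path d → Lattice d}
    (hA : IsAnchoring A) (hα : 0 < α) (hπ : ∀ᵐ x ∂π, x ∈ l0 d) :
    RepresentsAnchor A (paretoMixture α (spectralMeasure π α))
      ((anchoredSpectralMeasure π α Set.univ)⁻¹ • anchoredSpectralMeasure π α) := by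
  have hW := hA.measurableSet_anchoredPaths
  have setLIntegral_anchoredPaths : ∀ g : Path d → ℝ≥0, Measurable g → ShiftInvariantOn g (l0 d) →
      ∫⁻ y in anchoredPaths A, (g (normalize y) : ℝ≥0∞) ∂(paretoMixture α (spectralMeasure π α)) =
        ∫⁻ y, (g y : ℝ≥0∞) ∂(anchoredSpectralMeasure π α) := fun g hg hinv => by
    rw [← lintegral_indicator hW]
    exact lintegral_paretoMixture_eq_lintegral_anchoredSpectralMeasure hα hπ
      (Measurable.indicator (by fun_prop) hW) hg.coe_nnreal_ennreal
      fun z hz => hA.tsum_indicator_anchoredPaths_shift hinv hz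
  have mass_anchoredPaths : paretoMixture α (spectralMeasure π α) (anchoredPaths A) =
      anchoredSpectralMeasure π α Set.univ := by
    simpa using setLIntegral_anchoredPaths 1 measurable_one fun _ _ _ => rfl
  intro h hh hinv
  rw [lintegral_smul_measure, ← setLIntegral_anchoredPaths h hh hinv, ← mass_anchoredPaths,
    ← lintegral_smul_measure]
  rfl

lemma ae_anchoredSpectralMeasure_mem_l0 (hπ : ∀ᵐ x ∂π, x ∈ l0 d) :
    ∀ᵐ y ∂(anchoredSpectralMeasure π α), y ∈ l0 d := by
  refine (ae_map_iff (by fun_prop) measurableSet_l0).2 ?_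
  exact (withDensity_absolutelyContinuous _ _).ae_le (hπ.mono fun x hx => smul_mem_l0 hx _)

theorem isAnchoredSpectralRepresentative_smul_paretoMixture [SFinite π] (hα : 0 < α)
    (hπ : ∀ᵐ x ∂π, x ∈ l0 d) {a : ℝ≥0∞} (ha0 : a ≠ 0) (ha : a ≠ ∞) :
    IsAnchoredSpectralRepresentative (a • paretoMixture α (spectralMeasure π α))
      ((anchoredSpectralMeasure π α Set.univ)⁻¹ • anchoredSpectralMeasure π α) := by
  have representsAnchor : ∀ A : Path d → Lattice d, IsAnchoring A → RepresentsAnchor A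
      (a • paretoMixture α (spectralMeasure π α))
      ((anchoredSpectralMeasure π α Set.univ)⁻¹ • anchoredSpectralMeasure π α) := fun A hA => by
    have := hA.representsAnchor_anchoredSpectralMeasure hα hπ
    rwa [RepresentsAnchor, anchoredLaw, ← cond_smul_measure ha0 ha] at this
  exact ⟨Measure.ae_smul_measure (ae_anchoredSpectralMeasure_mem_l0 hπ) _,
    ⟨_, isAnchoring_lexMinExceedance d, representsAnchor _ (isAnchoring_lexMinExceedance d)⟩,
    representsAnchor⟩

end OrbitSums

/-! ### Moving-average laws -/

section MovingAverage

variable {d : ℕ} {α : ℝ} {Ω : Type*} [MeasurableSpace Ω] {P : Measure Ω} {C : Ω → Path d}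
  {κ : Ω → ℝ}

lemma lintegral_spectralMeasure_map (hC : Measurable C) (hκ : Measurable κ)
    (hκ_abs : ∀ᵐ ω ∂P, |κ ω| = 1) {F : Path d → ℝ≥0∞} (hF : Measurable F) :
    ∫⁻ y, F y ∂(spectralMeasure (P.map fun ω => κ ω • C ω) α) =
      ∫⁻ ω, ∑' k, F ((κ ω / |C ω k|) • shift k (C ω)) * ENNReal.ofReal (|C ω k| ^ α) ∂P := by
  rw [lintegral_spectralMeasure hF, lintegral_tsum fun k => by fun_prop]
  refine tsum_congr fun k => ?_
  rw [lintegral_map (by fun_prop) (by fun_prop)]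
  refine lintegral_congr_ae (hκ_abs.mono fun ω hω => ?_)
  have spectral_eq :
      spectral (shift k (κ ω • C ω)) = (κ ω / |C ω k|) • shift k (C ω) := by
    funext i
    simp only [spectral, shift, Pi.smul_apply, smul_eq_mul, zero_add, abs_mul, hω, one_mul]
    ring
  simp only [spectral_eq, Pi.smul_apply, smul_eq_mul, abs_mul, hω, one_mul]
  exact mul_comm _ _

lemma spectralMeasure_map_univ (hC : Measurable C) (hκ : Measurable κ)
    (hκ_abs : ∀ᵐ ω ∂P, |κ ω| = 1) :
    spectralMeasure (P.map fun ω => κ ω • C ω) α Set.univ = coeffMass P C α := by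
  rw [← lintegral_one, lintegral_spectralMeasure_map hC hκ hκ_abs measurable_const, coeffMass,
    ← lintegral_tsum fun k => by fun_prop]
  simp only [one_mul]

lemma IsMASpectralLaw.eq_smul_spectralMeasure (hC : Measurable C) (hκ : Measurable κ)
    (hκ_abs : ∀ᵐ ω ∂P, |κ ω| = 1) {μΘ : Measure (Path d)} (h : IsMASpectralLaw P C κ α μΘ) :
    μΘ = (coeffMass P C α)⁻¹ • spectralMeasure (P.map fun ω => κ ω • C ω) α := by
  ext B hB
  have hB1 : Measurable (B.indicator fun _ => (1 : ℝ≥0)) := measurable_const.indicator hB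
  have := h _ hB1
  rw [← lintegral_spectralMeasure_map hC hκ hκ_abs hB1.coe_nnreal_ennreal] at this
  simpa only [ENNReal.coe_indicator, ENNReal.coe_one, lintegral_indicator_const hB, one_mul,
    Measure.smul_apply, smul_eq_mul] using this

lemma lintegral_anchoredSpectralMeasure_map (hC : Measurable C) (hκ : Measurable κ)
    (hκ_abs : ∀ᵐ ω ∂P, |κ ω| = 1) {F : Path d → ℝ≥0∞} (hF : Measurable F) :
    ∫⁻ y, F y ∂(anchoredSpectralMeasure (P.map fun ω => κ ω • C ω) α) =
      ∫⁻ ω, F ((κ ω / supNorm (C ω)) • C ω) * ENNReal.ofReal (supNorm (C ω) ^ α) ∂P := by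
  rw [lintegral_anchoredSpectralMeasure hF, lintegral_map (by fun_prop) (by fun_prop)]
  refine lintegral_congr_ae (hκ_abs.mono fun ω hω => ?_)
  simp only [normalize, supNorm_smul, hω, one_mul, smul_smul, div_eq_inv_mul, mul_comm]

lemma anchoredSpectralMeasure_map_univ (hC : Measurable C) (hκ : Measurable κ)
    (hκ_abs : ∀ᵐ ω ∂P, |κ ω| = 1) :
    anchoredSpectralMeasure (P.map fun ω => κ ω • C ω) α Set.univ = normMoment P C α := by
  rw [← lintegral_one, lintegral_anchoredSpectralMeasure_map hC hκ hκ_abs measurable_const,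
    normMoment]
  simp only [one_mul]

lemma IsMAAnchoredLaw.eq_smul_anchoredSpectralMeasure (hC : Measurable C) (hκ : Measurable κ)
    (hκ_abs : ∀ᵐ ω ∂P, |κ ω| = 1) {μQ : Measure (Path d)} (h : IsMAAnchoredLaw P C κ α μQ) :
    μQ = (normMoment P C α)⁻¹ • anchoredSpectralMeasure (P.map fun ω => κ ω • C ω) α := by
  ext B hB
  rw [h B hB, ← lintegral_anchoredSpectralMeasure_map hC hκ hκ_abs
    (measurable_const.indicator hB), lintegral_indicator_const hB, one_mul, Measure.smul_apply,
    smul_eq_mul]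

end MovingAverage

end TailField

open TailField in
theorem mainTheorem7_general {d : ℕ} {Ω : Type*} [MeasurableSpace Ω] (P : Measure Ω)
    [IsFiniteMeasure P] (C : Ω → Path d) (hC : Measurable C) (α : ℝ) (hα : 0 < α)
    (hc_pos : 0 < coeffMass P C α) (hc_lt : coeffMass P C α < ∞)
    (κ : Ω → ℝ) (hκ : Measurable κ) (hκ_abs : ∀ᵐ ω ∂P, |κ ω| = 1) :
    (∀ μΘ, IsMASpectralLaw P C κ α μΘ → IsSpectralTailProcess α μΘ) ∧
    (∀ μY, IsTailProcess α μY → IsMASpectralLaw P C κ α (μY.map spectral) →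
      (∀ μQ, IsMAAnchoredLaw P C κ α μQ → IsAnchoredSpectralRepresentative μY μQ) ∧
      extremalIndex μY = normMoment P C α / coeffMass P C α) := by
  have hmass := spectralMeasure_map_univ (α := α) hC hκ hκ_abs
  have hnorm := anchoredSpectralMeasure_map_univ (α := α) hC hκ hκ_abs
  set π := P.map fun ω => κ ω • C ω
  have h0 : coeffMass P C α ≠ 0 := hc_pos.ne'
  have htop : coeffMass P C α ≠ ∞ := hc_lt.ne
  have hπ : ∀ᵐ x ∂π, x ∈ l0 d := ae_mem_l0 hα (hmass ▸ htop)
  refine ⟨fun μΘ hΘ => ?_, fun μY hY hΘ => ?_⟩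
  · rw [hΘ.eq_smul_spectralMeasure hC hκ hκ_abs, ← hmass]
    exact isSpectralTailProcess_spectralMeasure hα (hmass ▸ h0) (hmass ▸ htop)
  · rw [hY.eq_paretoMixture hα, hΘ.eq_smul_spectralMeasure hC hκ hκ_abs, paretoMixture_smul]
    refine ⟨fun μQ hQ => ?_, ?_⟩
    · rw [hQ.eq_smul_anchoredSpectralMeasure hC hκ hκ_abs, ← hnorm]
      exact isAnchoredSpectralRepresentative_smul_paretoMixture hα hπ
        (ENNReal.inv_ne_zero.2 htop) (ENNReal.inv_ne_top.2 h0)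
    · rw [extremalIndex_smul, extremalIndex_paretoMixture_spectralMeasure hα hπ, hnorm,
        ENNReal.div_eq_inv_mul]

theorem mainTheorem7 {d : ℕ} (hd : 1 ≤ d)
    {Ω : Type*} [MeasurableSpace Ω] (P : Measure Ω) [IsProbabilityMeasure P]
    (C : Ω → TailField.Path d) (hC : Measurable C) (hC0 : ∀ᵐ ω ∂P, C ω ∈ TailField.l0 d)
    (α : ℝ) (hα : 0 < α)
    (hc_pos : 0 < TailField.coeffMass P C α) (hc_lt : TailField.coeffMass P C α < ∞)
    (κ : Ω → ℝ) (hκ : Measurable κ) (hκ_sign : ∀ᵐ ω ∂P, κ ω = -1 ∨ κ ω = 1)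
    (hind : IndepFun C κ P) :
    -- (i)
    (∀ {Ω₁ : Type*} [MeasurableSpace Ω₁] (P₁ : Measure Ω₁) [IsProbabilityMeasure P₁]
        (Θ : Ω₁ → TailField.Path d), Measurable Θ → (∀ᵐ ω ∂P₁, Θ ω ∈ TailField.l0 d) →
        TailField.IsMASpectralLaw P C κ α (P₁.map Θ) →
        TailField.IsSpectralTailProcess α (P₁.map Θ)) ∧
    -- (ii)
    (∀ {Ω₂ : Type*} [MeasurableSpace Ω₂] (P₂ : Measure Ω₂) [IsProbabilityMeasure P₂]
        (Y : Ω₂ → TailField.Path d), Measurable Y → (∀ᵐ ω ∂P₂, Y ω ∈ TailField.l0 d) →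
        TailField.IsTailProcess α (P₂.map Y) →
        TailField.IsMASpectralLaw P C κ α (P₂.map (fun ω => TailField.spectral (Y ω))) →
        (∀ {Ω₃ : Type*} [MeasurableSpace Ω₃] (P₃ : Measure Ω₃) [IsProbabilityMeasure P₃]
            (Q : Ω₃ → TailField.Path d), Measurable Q → (∀ᵐ ω ∂P₃, Q ω ∈ TailField.l0 d) →
            TailField.IsMAAnchoredLaw P C κ α (P₃.map Q) →
            TailField.IsAnchoredSpectralRepresentative (P₂.map Y) (P₃.map Q)) ∧
        TailField.extremalIndex (P₂.map Y) =
          TailField.normMoment P C α / TailField.coeffMass P C α) := by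
  have hκ_abs : ∀ᵐ ω ∂P, |κ ω| = 1 := hκ_sign.mono fun ω hω => (abs_eq zero_le_one).2 hω.symm
  obtain ⟨spectral_law, anchored_law⟩ :=
    mainTheorem7_general P C hC α hα hc_pos hc_lt κ hκ hκ_abs
  refine ⟨fun P₁ _ Θ _ _ hΘ => spectral_law _ hΘ, fun P₂ _ Y hY _ hT hΘ => ?_⟩
  obtain ⟨representative, extremalIndex_eq⟩ := anchored_law _ hT <| by
    rwa [Measure.map_map TailField.measurable_spectral hY]
  exact ⟨fun P₃ _ Q _ _ hQ => representative _ hQ, extremalIndex_eq⟩
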